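/- For each $n\ge 1$ let $y_i=\mu_i+\sigma_n z_i$, $i=1,\dots,n$, where $\sigma_n>0$ is known, the $z_i$ are independent $N(0,1)$ variables, and $\mu\in\mathbb R^n$ lies in the ball $l_p[\eta_n]=\{\mu\in\mathbb R^n:\|\mu\|_p\le n^{1/p}\sigma_n\eta_n\}$, with $0<p\le\infty$, $\eta_n\ge 0$ (and $n^{1/\infty}=1$). Let $\pi_n$ be a probability distribution on $\{0,\dots,n\}$ with $\pi_n(\kappa)>0$ for all $\kappa$, and let $\gamma_n>0$. For $x\in\{0,1\}^n$ with $\kappa=\sum_i x_i$ consider the posterior probabilities $$\pi_n(x\mid y)\propto \binom n\kappa^{-1}\pi_n(\kappa)\prod_{i=1}^n (B_i^{-1})^{x_i},\qquad B_i=\sqrt{1+\gamma_n}\,\exp\Big\{-\frac{y_i^2}{2\sigma_n^2(1+1/\gamma_n)}\Big\},$$ which arise when $\kappa\sim\pi_n$, all $x$ with $\kappa$ ones are equally likely given $\kappa$, $\mu_i=0$ if $x_i=0$, and $\mu_i\sim N(0,\gamma_n\sigma_n^2)$ independently if $x_i=1$. Let $\hat x$ be a maximizer of $\pi_n(x\mid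 y)$, let $\hat\kappa=\sum_i\hat x_i$, and let $\hat\lambda$ be the $\hat\kappa$-th largest of $|y_1|,\dots,|y_n|$ ($\hat\lambda=+\infty$ if $\hat\kappa=0$). The Bayesian maximum a posteriori (MAP) estimator $\hat\mu$ of $\mu$ is $\hat\mu_i=y_i$ if $|y_i|\ge\hat\lambda$ and $\hat\mu_i=0$ otherwise. Assume that $\gamma_-\le\gamma_n\le\gamma_+$ for all $n$, with constants $0<\gamma_-\le\gamma_+$, and write $R_n(p,\eta_n)=\sup_{\mu\in l_p[\eta_n]}E\|\hat\mu-\mu\|_2^2$. Then, as $n\to\infty$: 1. Let $0<p\le\infty$. If $\pi_n(n)\ge e^{-c_0n}$ for some constant $c_0>0$, then $R_n(p,\eta_n)=O(n\sigma_n^2)$. 2. Let $2\le p\le\infty$. If $\pi_n(0)\ge n^{-c_1n^{-\beta}}$ for some constants $\beta\ge0$, $c_1>0$, then $R_n(p,\eta_n)=O(\sigma_n^2n\eta_n^2)+O(\sigma_n^2n^{-\beta}\log n)$. 3. Let $0<p<2$. If $\pi_n(\kappa)\ge(\kappa/n)^{c_2\kappa}$ for all integers $1\le\kappa\le\alpha_nn$,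 for some constant $c_2>0$ and some $\alpha_n$ with $n^{-1}(2\log n)^{p/2}\le\alpha_n\le\exp\{-8(\gamma_n+3/4)^2\}$, then $R_n(p,\eta_n)=O\big\{\sigma_n^2n\eta_n^p(2\log\eta_n^{-p})^{1-p/2}\big\}$ for all $\eta_n$ with $n^{-1}(2\log n)^{p/2}\le\eta_n^p\le\alpha_n$. 4. Let $0<p<2$. If $\pi_n(0)\ge n^{-c_1n^{-\beta}}$ for some constants $\beta\ge0$, $c_1>0$, then $R_n(p,\eta_n)=O(\sigma_n^2n^{2/p}\eta_n^2)+O(\sigma_n^2n^{-\beta}\log n)$ for all $\eta_n$ with $\eta_n^p<n^{-1}(2\log n)^{p/2}$. In each part, the constants implied by $O$, and the $n$ from which on the bound holds, depend only on $p,\gamma_-,\gamma_+$ and on those of the constants $c_0,c_1,c_2,\beta$ that occur in that part. -/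

import Mathlib

open scoped ENNReal

namespace GaussSeq

noncomputable section

/-- A prior on the number `κ ∈ {0, …, n}` of nonzero means: strictly positive weights of total
mass one (the values of `prior` beyond `n` play no role). -/
def IsPrior (n : ℕ) (prior : ℕ → ℝ) : Prop :=
  (∀ κ ≤ n, 0 < prior κ) ∧ ∑ κ ∈ Finset.range (n + 1), prior κ = 1

/-- The Bayes factor of `μ_i = 0` against `μ_i ∼ N(0, τ²)`, given the observation `t ∼ N(μ_i, σ²)`,
where `γ = τ² / σ²`. -/
def bayesFactor (σ γ t : ℝ) : ℝ :=
  Real.sqrt (1 + γ) * Real.exp (-(t ^ 2 / (2 * σ ^ 2 * (1 + 1 / γ))))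

/-- The unnormalised posterior weight, given the data `y`, of the configuration whose nonzero means
are exactly the `μ_i` with `i ∈ S`: the size `κ = #S` has prior weight `prior κ`, and all
configurations of the same size are equally likely a priori. -/
def posteriorWeight {n : ℕ} (σ γ : ℝ) (prior : ℕ → ℝ) (y : Fin n → ℝ) (S : Finset (Fin n)) : ℝ :=
  ((n.choose S.card : ℝ))⁻¹ * prior S.card * ∏ i ∈ S, (bayesFactor σ γ (y i))⁻¹

/-- The posterior probability of the configuration `S` given the data `y`. -/
def posteriorProb {n : ℕ} (σ γ : ℝ) (prior : ℕ → ℝ) (y : Fin n → ℝ) (S : Finset (Fin n)) : ℝ :=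
  posteriorWeight σ γ prior y S / ∑ T : Finset (Fin n), posteriorWeight σ γ prior y T

/-- `S` is a posterior mode, that is, a most likely configuration given the data `y`. -/
def IsPosteriorMode {n : ℕ} (σ γ : ℝ) (prior : ℕ → ℝ) (y : Fin n → ℝ) (S : Finset (Fin n)) :
    Prop :=
  ∀ T : Finset (Fin n), posteriorProb σ γ prior y T ≤ posteriorProb σ γ prior y S

/-- The threshold attached to the set `S` of rejected null hypotheses: the smallest `|y_i|`,
`i ∈ S`, and `⊤` if `S` is empty. A posterior mode with `κ` elements consists of the indices of `κ`
largest `|y_i|` (the Bayes factor is decreasing in `|y_i|`), so that for a mode this is the `κ`-th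
largest of the `|y_i|`. -/
def threshold {n : ℕ} (y : Fin n → ℝ) (S : Finset (Fin n)) : WithTop ℝ :=
  S.inf fun i => ((|y i| : ℝ) : WithTop ℝ)

open Classical in
/-- Hard thresholding: keep `y_i` if `|y_i| ≥ t` and replace it by `0` otherwise. -/
def hardThreshold {n : ℕ} (t : WithTop ℝ) (y : Fin n → ℝ) : Fin n → ℝ :=
  fun i => if t ≤ ((|y i| : ℝ) : WithTop ℝ) then y i else 0

/-- `est` is a Bayesian maximum a posteriori hard-thresholding estimator: for every `y`, it
thresholds `y` at the level given by a posterior mode. (For almost every `y` the mode is unique;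
the remaining ties may be broken in any way.) -/
def IsMAPEstimator (n : ℕ) (σ γ : ℝ) (prior : ℕ → ℝ) (est : (Fin n → ℝ) → Fin n → ℝ) : Prop :=
  ∀ y, ∃ S : Finset (Fin n), IsPosteriorMode σ γ prior y S ∧ est y = hardThreshold (threshold y S) y

/-- The strong `l_p`-ball of normalised radius `η`: all `μ ∈ ℝⁿ` with `‖μ‖_p ≤ n^{1/p} σ η`,
for `0 < p ≤ ∞` (with `1 / ∞ = 0`). -/
def lpBall (n : ℕ) (σ : ℝ) (p : ℝ≥0∞) (η : ℝ) : Set (Fin n → ℝ) :=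
  {μ | ‖(WithLp.toLp p μ : PiLp p fun _ : Fin n => ℝ)‖ ≤ (n : ℝ) ^ (p⁻¹).toReal * σ * η}

/-- The quadratic risk `E ‖est y - μ‖₂²` at `μ`, where `y_i = μ_i + σ z_i` and the `z_i` are
independent standard normal variables. -/
def risk {n : ℕ} (σ : ℝ) (est : (Fin n → ℝ) → Fin n → ℝ) (μ : Fin n → ℝ) : ℝ≥0∞ :=
  ∫⁻ z, ENNReal.ofReal (∑ i, (est (fun j => μ j + σ * z j) i - μ i) ^ 2)
    ∂(MeasureTheory.Measure.pi fun _ : Fin n => ProbabilityTheory.gaussianReal 0 1)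

/-- The maximal quadratic risk over the `l_p`-ball of normalised radius `η`. -/
def maxRisk {n : ℕ} (σ : ℝ) (est : (Fin n → ℝ) → Fin n → ℝ) (p : ℝ≥0∞) (η : ℝ) : ℝ≥0∞ :=
  ⨆ μ ∈ lpBall n σ p η, risk σ est μ

end

end GaussSeq

namespace GaussSeq

open MeasureTheory ProbabilityTheory

noncomputable section

/-! ### Binomial coefficients and the mode of the binomial law. -/

section Combinatorics

/-! Up to a constant, the log posterior of a configuration S is a Σ_S (y_i/σ)² − pen(|S|), where a =
γ/(2(1+γ)) and pen(k) = log C(n,k) − log π(k) + k log(1+γ)/2. A mode is thus a penalised maximiser.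
Comparing it with an arbitrary T (`loss_le_of_isMaximal`) bounds the loss by pen(|T|), the squared
means outside T, the noise on T, and the excess s Σ_S z_i² − pen(|S|) at the random mode S, with a
tilt s = a + g slightly above a.

The heart is `exists_excess_bound`: the excesses of all S together are dominated by one variable of
mean at most 1 − π(0) plus a polynomial times a geometric term. For |S| ≤ δn, a union bound with
exponential moments of order 1 + τ works: the penalty pays for the C(n,k) sets, and the surplus
C(n,k)^(−τ) absorbs the moments. For |S| > δn, exp(excess) is at most n + 1 times a product over
coordinates of mixtures 1 − x + x exp(s z² − log(1+γ)/2), x = |S|/n, which depends on S only through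
its size. For g = 0 each mixture has mean 1, so its square root has mean below 1, uniformly for x ≥
δ; a small g does not spoil this.

Taking means gives the oracle inequality `exists_oracle_bound`. The four parts are choices of T: all
indices for 1, none for 2 and 4, and for 3 essentially the means above σ√(2 log η^(−p)). -/

lemma pow_le_choose_mul_pow : ∀ {n k : ℕ}, k ≤ n → n ^ k ≤ n.choose k * k ^ k
  | n, 0, _ => by simp
  | 0, k + 1, h => by simp at h
  | n + 1, k + 1, h => by
    have hk : k ≤ n := by omega
    have ih := pow_le_choose_mul_pow hk
    -- Since k ≤ n, (n+1)/n ≤ (k+1)/k; its k-th power upgrades the induction hypothesis.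
    have key : (n + 1) ^ k ≤ n.choose k * (k + 1) ^ k := by
      rcases Nat.eq_zero_or_pos k with rfl | hpos
      · simp
      · have h1 : (n + 1) * k ≤ n * (k + 1) := by nlinarith
        have h2 : ((n + 1) * k) ^ k ≤ (n * (k + 1)) ^ k := Nat.pow_le_pow_left h1 k
        rw [mul_pow, mul_pow] at h2
        have h3 : (n + 1) ^ k * k ^ k ≤ (n.choose k * (k + 1) ^ k) * k ^ k := by
          calc (n + 1) ^ k * k ^ k ≤ n ^ k * (k + 1) ^ k := h2
            _ ≤ (n.choose k * k ^ k) * (k + 1) ^ k := Nat.mul_le_mul_right _ ih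
            _ = _ := by ring
        exact Nat.le_of_mul_le_mul_right h3 (by positivity)
    calc (n + 1) ^ (k + 1) = (n + 1) * (n + 1) ^ k := by ring
      _ ≤ (n + 1) * (n.choose k * (k + 1) ^ k) := Nat.mul_le_mul_left _ key
      _ = ((n + 1) * n.choose k) * (k + 1) ^ k := by ring
      _ = ((n + 1).choose (k + 1) * (k + 1)) * (k + 1) ^ k := by rw [Nat.add_one_mul_choose_eq]
      _ = _ := by ring

/-- The Poisson weight k^j / j! is largest at j = k. Applied to (k, j) and to (n − k, n − j), this
locates the mode of the binomial law. -/
lemma factorial_mul_pow_le_factorial_mul_pow (k j : ℕ) :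
    k.factorial * k ^ j ≤ j.factorial * k ^ k := by
  rcases le_total j k with h | h
  · obtain ⟨d, rfl⟩ := Nat.exists_eq_add_of_le h
    have h2 : (j + d).factorial ≤ j.factorial * (j + d) ^ d := by
      rw [← Nat.factorial_mul_ascFactorial]
      exact Nat.mul_le_mul_left _ (Nat.ascFactorial_le_pow_add j d)
    calc (j + d).factorial * (j + d) ^ j ≤ (j.factorial * (j + d) ^ d) * (j + d) ^ j :=
          Nat.mul_le_mul_right _ h2
      _ = _ := by rw [mul_assoc, ← pow_add, add_comm d j]
  · obtain ⟨d, rfl⟩ := Nat.exists_eq_add_of_le h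
    have h2 : k.factorial * k ^ d ≤ (k + d).factorial :=
      (Nat.mul_le_mul_left _ (Nat.pow_le_pow_left (Nat.le_succ k) d)).trans
        Nat.factorial_mul_pow_le_factorial
    calc k.factorial * k ^ (k + d) = (k.factorial * k ^ d) * k ^ k := by rw [pow_add]; ring
      _ ≤ _ := Nat.mul_le_mul_right _ h2

lemma choose_mul_pow_le {n k j : ℕ} (hk : k ≤ n) (hj : j ≤ n) :
    n.choose j * (k ^ j * (n - k) ^ (n - j)) ≤ n.choose k * (k ^ k * (n - k) ^ (n - k)) := by
  have h := Nat.mul_le_mul (factorial_mul_pow_le_factorial_mul_pow k j)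
    (factorial_mul_pow_le_factorial_mul_pow (n - k) (n - j))
  have hj' := Nat.choose_mul_factorial_mul_factorial hj
  have hk' := Nat.choose_mul_factorial_mul_factorial hk
  have hpos : 0 < (k.factorial * (n - k).factorial) * (j.factorial * (n - j).factorial) := by
    positivity
  refine Nat.le_of_mul_le_mul_right ?_ hpos
  calc n.choose j * (k ^ j * (n - k) ^ (n - j)) *
        ((k.factorial * (n - k).factorial) * (j.factorial * (n - j).factorial))
      = (n.choose j * j.factorial * (n - j).factorial) *
        ((k.factorial * k ^ j) * ((n - k).factorial * (n - k) ^ (n - j))) := by ring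
    _ ≤ (n.choose j * j.factorial * (n - j).factorial) *
        ((j.factorial * k ^ k) * ((n - j).factorial * (n - k) ^ (n - k))) :=
          Nat.mul_le_mul_left _ h
    _ = (n.choose k * k.factorial * (n - k).factorial) *
        ((j.factorial * k ^ k) * ((n - j).factorial * (n - k) ^ (n - k))) := by rw [hj', hk']
    _ = _ := by ring

/-- The most likely value of a binomial variable with parameters `n`, `k / n` is `k`. -/
lemma one_le_choose_mul_pow_mul_pow {n k : ℕ} (hn : 0 < n) (hk : k ≤ n) :
    1 ≤ ((n : ℝ) + 1) *
      (n.choose k * (((k : ℝ) / n) ^ k * (1 - (k : ℝ) / n) ^ (n - k))) := by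
  have h1 : n ^ n ≤ (n + 1) * (n.choose k * (k ^ k * (n - k) ^ (n - k))) := by
    calc n ^ n = (k + (n - k)) ^ n := by rw [Nat.add_sub_cancel' hk]
      _ = ∑ j ∈ Finset.range (n + 1), k ^ j * (n - k) ^ (n - j) * n.choose j := by
          rw [add_pow]; simp
      _ ≤ ∑ j ∈ Finset.range (n + 1), n.choose k * (k ^ k * (n - k) ^ (n - k)) := by
          refine Finset.sum_le_sum fun j hj => ?_
          rw [mul_comm]
          exact choose_mul_pow_le hk (by simpa [Nat.lt_succ_iff] using hj)
      _ = _ := by simp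
  have hn' : (0 : ℝ) < n := by exact_mod_cast hn
  have h2 : (n : ℝ) ^ n ≤ ((n : ℝ) + 1) * (n.choose k * ((k : ℝ) ^ k * ((n : ℝ) - k) ^ (n - k))) := by
    rw [← Nat.cast_sub hk]; exact_mod_cast h1
  have h3 : (n : ℝ) ^ n = (n : ℝ) ^ k * (n : ℝ) ^ (n - k) := by
    rw [← pow_add, Nat.add_sub_cancel' hk]
  have h4 : (1 - (k : ℝ) / n) = ((n : ℝ) - k) / n := by field_simp
  rw [h4, div_pow, div_pow]
  have : ((n : ℝ) + 1) * (n.choose k * ((k : ℝ) ^ k / (n : ℝ) ^ k * (((n : ℝ) - k) ^ (n - k) /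
      (n : ℝ) ^ (n - k)))) = ((n : ℝ) + 1) * (n.choose k * ((k : ℝ) ^ k * ((n : ℝ) - k) ^ (n - k)))
      / (n : ℝ) ^ n := by
    rw [h3]; field_simp
  rw [this, le_div_iff₀ (by positivity), one_mul]
  exact h2

lemma log_choose_le {n k : ℕ} (hk : 1 ≤ k) (hkn : k ≤ n) :
    Real.log (n.choose k) ≤ k * Real.log ((n : ℝ) / k) + k := by
  have hk0 : (0 : ℝ) < k := by exact_mod_cast hk
  have hn0 : (0 : ℝ) < n := by exact_mod_cast (lt_of_lt_of_le hk hkn)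
  have h1 : (n.choose k : ℝ) ≤ ((n : ℝ) / k) ^ k * Real.exp k := by
    calc (n.choose k : ℝ) ≤ (n : ℝ) ^ k / k.factorial := Nat.choose_le_pow_div k n
      _ = ((n : ℝ) / k) ^ k * ((k : ℝ) ^ k / k.factorial) := by
          rw [div_pow]; field_simp
      _ ≤ _ := by gcongr; exact Real.pow_div_factorial_le_exp _ hk0.le k
  have h2 : (0 : ℝ) < n.choose k := by exact_mod_cast Nat.choose_pos hkn
  calc Real.log (n.choose k) ≤ Real.log (((n : ℝ) / k) ^ k * Real.exp k) := Real.log_le_log h2 h1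
    _ = _ := by rw [Real.log_mul (by positivity) (by positivity), Real.log_pow, Real.log_exp]

end Combinatorics

/-! ### Gaussian moments and absence of ties. -/

section Gaussian

lemma gaussianPDFReal_smul_exp_mul_sq (s x : ℝ) :
    gaussianPDFReal 0 1 x • Real.exp (s * x ^ 2) =
      (Real.sqrt (2 * Real.pi))⁻¹ * Real.exp (-(1 / 2 - s) * x ^ 2) := by
  simp only [gaussianPDFReal, smul_eq_mul, NNReal.coe_one, mul_one, sub_zero]
  rw [mul_assoc, ← Real.exp_add]
  congr 2; ring

lemma integrable_exp_mul_sq_gaussianReal {s : ℝ} (hs : s < 1 / 2) :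
    Integrable (fun z : ℝ => Real.exp (s * z ^ 2)) (gaussianReal 0 1) := by
  rw [gaussianReal_of_var_ne_zero _ one_ne_zero,
    integrable_withDensity_iff_integrable_smul' (measurable_gaussianPDF _ _)
      (ae_of_all _ fun _ => gaussianPDF_lt_top)]
  simp_rw [toReal_gaussianPDF, gaussianPDFReal_smul_exp_mul_sq]
  exact (integrable_exp_neg_mul_sq (by linarith)).const_mul _

lemma integral_exp_mul_sq_gaussianReal {s : ℝ} (hs : s < 1 / 2) :
    ∫ z : ℝ, Real.exp (s * z ^ 2) ∂(gaussianReal 0 1) = (Real.sqrt (1 - 2 * s))⁻¹ := by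
  rw [integral_gaussianReal_eq_integral_smul one_ne_zero]
  simp_rw [gaussianPDFReal_smul_exp_mul_sq]
  rw [integral_const_mul, integral_gaussian, ← Real.sqrt_inv, ← Real.sqrt_inv,
    ← Real.sqrt_mul (by positivity)]
  congr 1
  have : (1 / 2 - s) ≠ 0 := by linarith
  have : (1 - 2 * s) ≠ 0 := by linarith
  field_simp

lemma integrable_sq_gaussianReal : Integrable (fun z : ℝ => z ^ 2) (gaussianReal 0 1) := by
  refine Integrable.mono' ((integrable_exp_mul_sq_gaussianReal (s := 1 / 4) (by norm_num)).const_mul 4)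
    (by fun_prop) (ae_of_all _ fun z => ?_)
  rw [Real.norm_of_nonneg (sq_nonneg z)]
  have := Real.add_one_le_exp (1 / 4 * z ^ 2)
  linarith

lemma integral_sq_gaussianReal : ∫ z : ℝ, z ^ 2 ∂(gaussianReal 0 1) = 1 := by
  have h := variance_id_gaussianReal (μ := 0) (v := 1)
  rw [variance_of_integral_eq_zero (by fun_prop) (by simp)] at h
  simpa using h

lemma gaussianReal_real_Ioo_pos {b : ℝ} (hb : 0 < b) : 0 < (gaussianReal 0 1).real (Set.Ioo (-b) b) := by
  rw [measureReal_def, ENNReal.toReal_pos_iff]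
  refine ⟨?_, measure_lt_top _ _⟩
  rw [pos_iff_ne_zero]
  intro h
  have := gaussianReal_absolutelyContinuous' 0 (v := 1) one_ne_zero h
  rw [Real.volume_Ioo, ENNReal.ofReal_eq_zero] at this
  linarith

/-- By independence and Fubini: once z_j is fixed, z_i would have to hit a single point. Used with d
= ±1 to exclude ties among the |y_i|. -/
lemma ae_ne_add_mul (n : ℕ) (c d : ℝ) {i j : Fin n} (hij : i ≠ j) :
    ∀ᵐ z ∂(Measure.pi fun _ : Fin n => gaussianReal 0 1), z i ≠ c + d * z j := by
  have hind : iIndepFun (fun i (z : Fin n → ℝ) => z i)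
      (Measure.pi fun _ : Fin n => gaussianReal 0 1) :=
    iIndepFun_pi (X := fun _ x => x) (fun _ => aemeasurable_id)
  have h2 := (hind.indepFun hij.symm).map_prod_eq_prod_map_map
    (measurable_pi_apply j).aemeasurable (measurable_pi_apply i).aemeasurable
  rw [(measurePreserving_eval _ i).map_eq, (measurePreserving_eval _ j).map_eq] at h2
  have hs : MeasurableSet {q : ℝ × ℝ | q.2 = c + d * q.1} :=
    measurableSet_eq_fun (by fun_prop) (by fun_prop)
  have h0 : ((gaussianReal 0 1).prod (gaussianReal 0 1)) {q : ℝ × ℝ | q.2 = c + d * q.1} = 0 := by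
    rw [Measure.measure_prod_null hs]
    have := nullSingletonClass_gaussianReal (μ := 0) (v := 1) one_ne_zero
    refine ae_of_all _ fun x => ?_
    have : Prod.mk x ⁻¹' {q : ℝ × ℝ | q.2 = c + d * q.1} = {c + d * x} := by ext; simp
    simp [this]
  rw [← h2, Measure.map_apply (by fun_prop) hs] at h0
  rw [ae_iff]
  convert h0 using 2
  ext z; simp

end Gaussian

/-! ### Posterior modes as penalised maximisers. -/

/-- The penalty attached by the posterior to configurations with `k` nonzero means. -/
def penalty (n : ℕ) (γ : ℝ) (prior : ℕ → ℝ) (k : ℕ) : ℝ :=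
  Real.log (n.choose k) - Real.log (prior k) + k * (Real.log (1 + γ) / 2)

/-- The reward per unit of the squared normalised observation. -/
def reward (γ : ℝ) : ℝ := γ / (2 * (1 + γ))

section Mode

variable {n : ℕ} {σ γ : ℝ} {prior : ℕ → ℝ} {y : Fin n → ℝ}

lemma inv_bayesFactor (hγ : 0 < γ) (t : ℝ) :
    (bayesFactor σ γ t)⁻¹ = Real.exp (reward γ * (t / σ) ^ 2 - Real.log (1 + γ) / 2) := by
  have h1 : Real.sqrt (1 + γ) = Real.exp (Real.log (1 + γ) / 2) := by
    rw [← Real.log_sqrt (by linarith), Real.exp_log (Real.sqrt_pos.2 (by linarith))]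
  rw [bayesFactor, h1, ← Real.exp_add, ← Real.exp_neg]
  congr 1
  have h2 : t ^ 2 / (2 * σ ^ 2 * (1 + 1 / γ)) = reward γ * (t / σ) ^ 2 := by
    -- For σ = 0 both sides vanish by the convention for division by zero.
    rcases eq_or_ne σ 0 with rfl | hσ
    · simp
    · have : 1 + γ ≠ 0 := by linarith
      have : γ + 1 ≠ 0 := by linarith
      rw [reward]; field_simp
      ring
  rw [h2]; ring

lemma posteriorWeight_eq_exp (hγ : 0 < γ) (hprior : ∀ κ ≤ n, 0 < prior κ)
    (S : Finset (Fin n)) :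
    posteriorWeight σ γ prior y S =
      Real.exp (reward γ * ∑ i ∈ S, (y i / σ) ^ 2 - penalty n γ prior S.card) := by
  have hcard : S.card ≤ n := by simpa using S.card_le_univ
  have hC : (0 : ℝ) < n.choose S.card := by exact_mod_cast Nat.choose_pos hcard
  rw [posteriorWeight, Finset.prod_congr rfl fun i _ => inv_bayesFactor hγ (y i),
    ← Real.exp_sum, Finset.sum_sub_distrib, ← Finset.mul_sum, penalty]
  conv_lhs => rw [← Real.exp_log hC, ← Real.exp_log (hprior _ hcard), ← Real.exp_neg,
    ← Real.exp_add, ← Real.exp_add]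
  congr 1
  simp; ring

lemma IsPosteriorMode.le (hγ : 0 < γ) (hprior : ∀ κ ≤ n, 0 < prior κ) {S : Finset (Fin n)}
    (hS : IsPosteriorMode σ γ prior y S) (T : Finset (Fin n)) :
    reward γ * ∑ i ∈ T, (y i / σ) ^ 2 - penalty n γ prior T.card ≤
      reward γ * ∑ i ∈ S, (y i / σ) ^ 2 - penalty n γ prior S.card := by
  have hpos : 0 < ∑ T : Finset (Fin n), posteriorWeight σ γ prior y T :=
    Finset.sum_pos (fun T _ => by rw [posteriorWeight_eq_exp hγ hprior]; positivity) ⟨∅, by simp⟩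
  have h := hS T
  rw [posteriorProb, posteriorProb, div_le_div_iff_of_pos_right hpos,
    posteriorWeight_eq_exp hγ hprior, posteriorWeight_eq_exp hγ hprior, Real.exp_le_exp] at h
  exact h

lemma reward_pos (hγ : 0 < γ) : 0 < reward γ := by unfold reward; positivity

/-- A posterior mode consists of indices of largest absolute observations. -/
lemma IsPosteriorMode.abs_le_abs (hσ : 0 < σ) (hγ : 0 < γ) (hprior : ∀ κ ≤ n, 0 < prior κ)
    {S : Finset (Fin n)} (hS : IsPosteriorMode σ γ prior y S) {i j : Fin n} (hi : i ∉ S)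
    (hj : j ∈ S) : |y i| ≤ |y j| := by
  have hi' : i ∉ S.erase j := fun h => hi (Finset.mem_of_mem_erase h)
  -- Exchanging j for i keeps the size, so the penalties cancel and only the energies are compared.
  have h := hS.le hγ hprior (insert i (S.erase j))
  rw [Finset.card_insert_of_notMem hi', Finset.card_erase_add_one hj, Finset.sum_insert hi',
    ← Finset.add_sum_erase S _ hj] at h
  have h2 : (y i / σ) ^ 2 ≤ (y j / σ) ^ 2 := by
    have := reward_pos hγ
    by_contra hlt
    nlinarith
  rw [sq_le_sq, abs_div, abs_div, div_le_div_iff_of_pos_right (abs_pos.2 hσ.ne')] at h2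
  exact h2

/-- An index outside the mode survives thresholding only if it ties with the smallest observation
inside; without ties exactly the mode is kept. -/
lemma IsPosteriorMode.hardThreshold_eq (hσ : 0 < σ) (hγ : 0 < γ)
    (hprior : ∀ κ ≤ n, 0 < prior κ) {S : Finset (Fin n)} (hS : IsPosteriorMode σ γ prior y S)
    (hy : ∀ i j, i ≠ j → |y i| ≠ |y j|) (i : Fin n) :
    hardThreshold (threshold y S) y i = if i ∈ S then y i else 0 := by
  unfold hardThreshold threshold
  by_cases hi : i ∈ S
  · rw [if_pos hi, if_pos (Finset.inf_le hi)]
  · rw [if_neg hi, if_neg]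
    rw [not_le, Finset.lt_inf_iff (WithTop.coe_lt_top _)]
    intro j hj
    rw [WithTop.coe_lt_coe]
    exact lt_of_le_of_ne (hS.abs_le_abs hσ hγ hprior hi hj) (hy i j (by rintro rfl; exact hi hj))

end Mode

/-! ### Deterministic comparison of a maximiser with a competitor. -/

/-- The excess of the tilted noise energy of `S` over the penalty. -/
def excess {n : ℕ} (s γ : ℝ) (prior : ℕ → ℝ) (z : Fin n → ℝ) (S : Finset (Fin n)) : ℝ :=
  s * ∑ i ∈ S, z i ^ 2 - penalty n γ prior S.card

/-- Young's inequality for the cross term. Only g/2 is added to the noise coefficient; the other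
half of the tilt g is kept to pay for the loss. -/
lemma mul_add_sq_le {a g : ℝ} (hg : 0 < g) (m z : ℝ) :
    a * (m + z) ^ 2 ≤ (a + g / 2) * z ^ 2 + (a + 2 * a ^ 2 / g) * m ^ 2 := by
  have h : 0 ≤ (g * z - 2 * a * m) ^ 2 / (2 * g) := by positivity
  have h2 : (g * z - 2 * a * m) ^ 2 / (2 * g) = g / 2 * z ^ 2 - 2 * a * m * z + 2 * a ^ 2 / g * m ^ 2 := by
    field_simp; ring
  nlinarith

/-- Energies on S ∩ T cancel. Noise wrongly kept on S \ T is paid by the spare tilt g/2. A mean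
missed on T \ S satisfies m² ≤ 2(m + z)² + 2z², and the energy missed there is bounded through
maximality of S. -/
lemma loss_le_of_isMaximal {n : ℕ} {a g γ : ℝ} {prior : ℕ → ℝ} (ha : 0 < a) (hg : 0 < g)
    {m z : Fin n → ℝ} {S T : Finset (Fin n)}
    (h : a * ∑ i ∈ T, (m i + z i) ^ 2 - penalty n γ prior T.card ≤
      a * ∑ i ∈ S, (m i + z i) ^ 2 - penalty n γ prior S.card) :
    ∑ i ∈ S, z i ^ 2 + ∑ i ∈ Sᶜ, m i ^ 2 ≤
      (2 / g + 2 / a) * (penalty n γ prior T.card + (a + 2 * a ^ 2 / g) * ∑ i ∈ Tᶜ, m i ^ 2 +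
        excess (a + g) γ prior z S) + 3 * ∑ i ∈ T, z i ^ 2 + ∑ i ∈ Tᶜ, m i ^ 2 := by
  classical
  set t : Fin n → ℝ := fun i => m i + z i with ht
  have hS : ∀ f : Fin n → ℝ, ∑ i ∈ S, f i = ∑ i ∈ S \ T, f i + ∑ i ∈ S ∩ T, f i := fun f => by
    rw [add_comm]; exact (Finset.sum_inter_add_sum_sdiff S T f).symm
  have hT : ∀ f : Fin n → ℝ, ∑ i ∈ T, f i = ∑ i ∈ T \ S, f i + ∑ i ∈ S ∩ T, f i := fun f => by
    rw [add_comm, Finset.inter_comm]; exact (Finset.sum_inter_add_sum_sdiff T S f).symm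
  have hSc : ∑ i ∈ Sᶜ, m i ^ 2 ≤ ∑ i ∈ T \ S, m i ^ 2 + ∑ i ∈ Tᶜ, m i ^ 2 := by
    refine (Finset.sum_le_sum_of_subset_of_nonneg (t := T \ S ∪ Tᶜ) ?_
      fun _ _ _ => sq_nonneg _).trans ?_
    · intro i hi; by_cases hiT : i ∈ T <;> simp_all
    · rw [Finset.sum_union]
      refine Finset.disjoint_left.2 fun i hi hi' => ?_
      simp_all
  have hM : ∑ i ∈ S \ T, m i ^ 2 ≤ ∑ i ∈ Tᶜ, m i ^ 2 :=
    Finset.sum_le_sum_of_subset_of_nonneg (fun i hi => by simp_all) fun _ _ _ => sq_nonneg _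
  have h1 : a * ∑ i ∈ S \ T, t i ^ 2 ≤ (a + g / 2) * ∑ i ∈ S \ T, z i ^ 2 +
      (a + 2 * a ^ 2 / g) * ∑ i ∈ S \ T, m i ^ 2 := by
    rw [Finset.mul_sum, Finset.mul_sum, Finset.mul_sum, ← Finset.sum_add_distrib]
    exact Finset.sum_le_sum fun i _ => mul_add_sq_le hg _ _
  have h2 : ∑ i ∈ T \ S, m i ^ 2 ≤ 2 * ∑ i ∈ T \ S, t i ^ 2 + 2 * ∑ i ∈ T \ S, z i ^ 2 := by
    rw [Finset.mul_sum, Finset.mul_sum, ← Finset.sum_add_distrib]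
    exact Finset.sum_le_sum fun i _ => by
      simp only [ht]; nlinarith [sq_nonneg (m i + 2 * z i)]
  have h3 : (a + 2 * a ^ 2 / g) * ∑ i ∈ S \ T, m i ^ 2 ≤
      (a + 2 * a ^ 2 / g) * ∑ i ∈ Tᶜ, m i ^ 2 := by gcongr
  have nn : ∀ (A : Finset (Fin n)) (f : Fin n → ℝ), 0 ≤ ∑ i ∈ A, f i ^ 2 := fun A f =>
    Finset.sum_nonneg fun _ _ => sq_nonneg _
  have e1 := nn (S \ T) z
  have e2 := nn (S ∩ T) z
  have e3 := nn (T \ S) z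
  have e4 := nn (T \ S) t
  rw [excess, hS (fun i => z i ^ 2), hT (fun i => z i ^ 2)]
  rw [hS (fun i => (m i + z i) ^ 2), hT (fun i => (m i + z i) ^ 2)] at h
  set P := penalty n γ prior T.card
  set Q := penalty n γ prior S.card
  set M := ∑ i ∈ Tᶜ, m i ^ 2
  set R := P + (a + 2 * a ^ 2 / g) * M +
    ((a + g) * (∑ i ∈ S \ T, z i ^ 2 + ∑ i ∈ S ∩ T, z i ^ 2) - Q) with hR
  -- Adding (g/2) Σ z² over S \ T to the comparison raises the noise coefficient to a + g; the noise
  -- on S ∩ T is added for free to complete the excess of S.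
  have key : a * ∑ i ∈ T \ S, t i ^ 2 + g / 2 * ∑ i ∈ S \ T, z i ^ 2 ≤ R := by
    have : 0 ≤ (a + g) * ∑ i ∈ S ∩ T, z i ^ 2 := by positivity
    simp only [ht] at *
    nlinarith
  have k1 : ∑ i ∈ T \ S, t i ^ 2 ≤ R / a := by
    rw [le_div_iff₀ ha]; nlinarith
  have k2 : ∑ i ∈ S \ T, z i ^ 2 ≤ 2 * R / g := by
    rw [le_div_iff₀ hg]; nlinarith
  have : (2 / g + 2 / a) * R = 2 * R / g + 2 * (R / a) := by ring
  rw [this]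
  linarith

/-- The square of the right side is 1 + w − w³/8 + w⁴/64. The quadratic term is what later brings
the mean of the square root below 1. -/
lemma sqrt_one_add_le_quadratic {w : ℝ} (h1 : -1 ≤ w) (h2 : w ≤ 0) :
    Real.sqrt (1 + w) ≤ 1 + w / 2 - w ^ 2 / 8 := by
  apply Real.sqrt_le_iff.2
  constructor
  · nlinarith
  · have : 0 ≤ -w ^ 3 := by nlinarith [sq_nonneg w]
    nlinarith [sq_nonneg (w ^ 2)]

lemma sqrt_one_add_le_linear {w : ℝ} (h1 : -1 ≤ w) : Real.sqrt (1 + w) ≤ 1 + w / 2 := by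
  apply Real.sqrt_le_iff.2
  constructor
  · linarith
  · nlinarith [sq_nonneg w]

/-! ### Mean of the square root of a tilted mixture. -/

section TiltedFactor

variable {s a b x u : ℝ}

/-- The mixture of `1` and the tilted factor `exp (s z² - a)`, with weight `x` on the latter. -/
def tiltedMixture (s a x z : ℝ) : ℝ := 1 - x + x * Real.exp (s * z ^ 2 - a)

lemma continuous_tiltedMixture : Continuous (tiltedMixture s a x) := by
  unfold tiltedMixture; fun_prop

lemma tiltedMixture_nonneg (hx0 : 0 ≤ x) (hx1 : x ≤ 1) (z : ℝ) : 0 ≤ tiltedMixture s a x z := by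
  have : 0 ≤ x * Real.exp (s * z ^ 2 - a) := by positivity
  unfold tiltedMixture; linarith

lemma integrable_tilted (hs : s < 1 / 2) :
    Integrable (fun z : ℝ => Real.exp (s * z ^ 2 - a)) (gaussianReal 0 1) := by
  simp_rw [Real.exp_sub]
  exact (integrable_exp_mul_sq_gaussianReal hs).div_const _

/-- The tangent bound holds everywhere. For z² < b the exponent is at most b/2 − b = −b/2, so the
mixture stays away from 1 and the second-order gain applies. -/
lemma sqrt_tiltedMixture_le (hs : s < 1 / 2) (hb : 0 ≤ b) (hba : b ≤ a)
    (hx0 : 0 ≤ x) (hx1 : x ≤ 1) (z : ℝ) :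
    Real.sqrt (tiltedMixture s a x z) ≤ 1 + x / 2 * (Real.exp (s * z ^ 2 - a) - 1) -
      (Set.Ioo (-√b) (√b)).indicator (fun _ => x ^ 2 / 8 * (1 - Real.exp (-(b / 2))) ^ 2) z := by
  set Y := Real.exp (s * z ^ 2 - a) with hY
  have hY0 : 0 < Y := Real.exp_pos _
  have hw : -1 ≤ x * (Y - 1) := by nlinarith
  have e : tiltedMixture s a x z = 1 + x * (Y - 1) := by simp only [tiltedMixture, ← hY]; ring
  rw [e]
  by_cases hz : z ∈ Set.Ioo (-√b) (√b)
  · rw [Set.indicator_of_mem hz]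
    have hz2 : z ^ 2 < b := by
      have := sq_lt_sq' hz.1 hz.2
      rwa [Real.sq_sqrt hb] at this
    have hYle : Y ≤ Real.exp (-(b / 2)) := Real.exp_le_exp.2 (by nlinarith [sq_nonneg z])
    have hle1 : Real.exp (-(b / 2)) ≤ 1 := Real.exp_le_one_iff.2 (by linarith)
    have hsq : (1 - Real.exp (-(b / 2))) ^ 2 ≤ (Y - 1) ^ 2 := by nlinarith
    have h := sqrt_one_add_le_quadratic hw (by nlinarith)
    have : x ^ 2 * (1 - Real.exp (-(b / 2))) ^ 2 ≤ x ^ 2 * (Y - 1) ^ 2 := by gcongr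
    nlinarith
  · rw [Set.indicator_of_notMem hz]
    have h := sqrt_one_add_le_linear hw
    linarith

lemma integrable_sqrt_tiltedMixture (hs : s < 1 / 2) (ha : 0 ≤ a) (hx0 : 0 ≤ x)
    (hx1 : x ≤ 1) :
    Integrable (fun z => Real.sqrt (tiltedMixture s a x z)) (gaussianReal 0 1) := by
  refine Integrable.mono' (((integrable_tilted (a := a) hs).sub (integrable_const 1)).const_mul
    (x / 2) |>.add (integrable_const 1))
    (Real.continuous_sqrt.comp continuous_tiltedMixture).aestronglyMeasurable
    (ae_of_all _ fun z => ?_)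
  rw [Real.norm_of_nonneg (Real.sqrt_nonneg _)]
  have := sqrt_tiltedMixture_le hs le_rfl ha hx0 hx1 z
  simp at this ⊢
  linarith

/-- For g = 0 the integrand is a likelihood ratio, of mean exactly 1. With g the mean is (1 −
2g(1+γ))^(−1/2), and (1+u)²(1−u) ≥ 1 for 0 ≤ u ≤ 1/2. -/
lemma integral_tilted_le {γ g : ℝ} (hγ : 0 < γ) (hu : u ≤ 1 / 2)
    (hgu : 2 * g * (1 + γ) ≤ u) (hg : 0 ≤ g) :
    ∫ z : ℝ, Real.exp ((reward γ + g) * z ^ 2 - Real.log (1 + γ) / 2) ∂(gaussianReal 0 1) ≤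
      1 + u := by
  have hu0 : 0 ≤ u := le_trans (by positivity) hgu
  have e1 : (1 + γ) * (1 - 2 * (reward γ + g)) = 1 - 2 * g * (1 + γ) := by
    unfold reward; field_simp; ring
  have hs : reward γ + g < 1 / 2 := by
    by_contra hcon
    have : (1 + γ) * (1 - 2 * (reward γ + g)) ≤ 0 :=
      mul_nonpos_of_nonneg_of_nonpos (by linarith) (by linarith)
    linarith
  simp_rw [Real.exp_sub]
  rw [integral_div, integral_exp_mul_sq_gaussianReal hs, ← Real.log_sqrt (by linarith),
    Real.exp_log (Real.sqrt_pos.2 (by linarith)), div_eq_mul_inv, ← mul_inv,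
    ← Real.sqrt_mul (by linarith), mul_comm, e1]
  have h1 : 1 ≤ (1 + u) * √(1 - 2 * g * (1 + γ)) := by
    have : (1 + u)⁻¹ ≤ √(1 - 2 * g * (1 + γ)) := by
      apply Real.le_sqrt_of_sq_le
      rw [inv_pow, inv_le_comm₀ (by positivity) (by linarith), inv_le_iff_one_le_mul₀ (by linarith)]
      have : 0 ≤ (1 + u) ^ 2 := by positivity
      nlinarith [sq_nonneg u]
    rw [inv_le_iff_one_le_mul₀ (by positivity)] at this
    linarith
  rw [inv_le_iff_one_le_mul₀ (Real.sqrt_pos.2 (by linarith))]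
  exact h1

lemma integral_sqrt_tiltedMixture_le {γ g q : ℝ} (hb : 0 ≤ b) (hγ : 0 < γ) (hu : u ≤ 1 / 2)
    (hgu : 2 * g * (1 + γ) ≤ u) (hg : 0 ≤ g) (hba : b ≤ Real.log (1 + γ) / 2)
    (hq : q = (gaussianReal 0 1).real (Set.Ioo (-√b) (√b)) * (1 - Real.exp (-(b / 2))) ^ 2)
    (hx0 : 0 ≤ x) (hx1 : x ≤ 1) :
    ∫ z, Real.sqrt (tiltedMixture (reward γ + g) (Real.log (1 + γ) / 2) x z) ∂(gaussianReal 0 1) ≤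
      1 + u / 2 - x ^ 2 * q / 8 := by
  have hu0 : 0 ≤ u := le_trans (by positivity) hgu
  have hs0 : 0 ≤ reward γ + g := by have := reward_pos hγ; linarith
  have hs : reward γ + g < 1 / 2 := by
    have e1 : (1 + γ) * (1 - 2 * (reward γ + g)) = 1 - 2 * g * (1 + γ) := by
      unfold reward; field_simp; ring
    by_contra hcon
    have : (1 + γ) * (1 - 2 * (reward γ + g)) ≤ 0 :=
      mul_nonpos_of_nonneg_of_nonpos (by linarith) (by linarith)
    linarith
  have hI := integrable_tilted (a := Real.log (1 + γ) / 2) hs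
  have i1 : Integrable (fun z : ℝ => x / 2 * (Real.exp ((reward γ + g) * z ^ 2 -
      Real.log (1 + γ) / 2) - 1)) (gaussianReal 0 1) :=
    (hI.sub (integrable_const 1)).const_mul (x / 2)
  have i2 : Integrable ((Set.Ioo (-√b) (√b)).indicator
      (fun _ : ℝ => x ^ 2 / 8 * (1 - Real.exp (-(b / 2))) ^ 2)) (gaussianReal 0 1) :=
    (integrable_const _).indicator measurableSet_Ioo
  refine (integral_mono (integrable_sqrt_tiltedMixture hs (hb.trans hba) hx0 hx1)
    (((integrable_const 1).add i1).sub i2)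
    fun z => sqrt_tiltedMixture_le hs hb hba hx0 hx1 z).trans ?_
  rw [integral_sub' ((integrable_const 1).add i1) i2, integral_add' (integrable_const 1) i1,
    integral_const_mul, integral_indicator_const _ measurableSet_Ioo]
  have h1 : ∫ z : ℝ, (Real.exp ((reward γ + g) * z ^ 2 - Real.log (1 + γ) / 2) - 1)
      ∂(gaussianReal 0 1) ≤ u := by
    rw [integral_sub hI (integrable_const 1)]
    have := integral_tilted_le hγ hu hgu hg
    simp only [integral_const, probReal_univ, smul_eq_mul, mul_one]
    linarith
  have h2 : x / 2 * ∫ z : ℝ, (Real.exp ((reward γ + g) * z ^ 2 - Real.log (1 + γ) / 2) - 1)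
      ∂(gaussianReal 0 1) ≤ 1 / 2 * u := by
    refine (mul_le_mul_of_nonneg_left h1 (by linarith)).trans ?_
    gcongr
  rw [hq]
  simp only [integral_const, probReal_univ, smul_eq_mul, mul_one]
  linarith

end TiltedFactor

/-! ### Exponential moments of the excess. -/

section Excess

variable {n : ℕ} {γ s r : ℝ} {prior : ℕ → ℝ}

lemma IsPrior.le_one (h : IsPrior n prior) {k : ℕ} (hk : k ≤ n) : prior k ≤ 1 := by
  rw [← h.2]
  exact Finset.single_le_sum (f := prior) (fun i hi => (h.1 i (by simpa [Nat.lt_succ_iff] using hi)).le)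
    (by simpa [Nat.lt_succ_iff] using hk)

lemma IsPrior.sum_eq (h : IsPrior n prior) : ∑ k ∈ Finset.range n, prior (k + 1) = 1 - prior 0 := by
  have := h.2
  rw [Finset.sum_range_succ'] at this
  linarith

lemma exp_mul_excess (z : Fin n → ℝ) (T : Finset (Fin n)) :
    Real.exp (r * excess s γ prior z T) =
      Real.exp (-(r * penalty n γ prior T.card)) *
        ∏ i, if i ∈ T then Real.exp (r * s * z i ^ 2) else 1 := by
  rw [Finset.prod_ite_mem, Finset.univ_inter, ← Real.exp_sum, ← Real.exp_add, excess,
    ← Finset.mul_sum]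
  congr 1; ring

lemma integrable_exp_mul_excess (hrs : r * s < 1 / 2) (T : Finset (Fin n)) :
    Integrable (fun z => Real.exp (r * excess s γ prior z T))
      (Measure.pi fun _ : Fin n => gaussianReal 0 1) := by
  simp_rw [exp_mul_excess]
  refine Integrable.const_mul (Integrable.fintype_prod
    (f := fun i x => if i ∈ T then Real.exp (r * s * x ^ 2) else 1) fun i => ?_) _
  by_cases hi : i ∈ T
  · simpa [hi] using integrable_exp_mul_sq_gaussianReal hrs
  · simp [hi]

lemma integral_exp_mul_excess (hrs : r * s < 1 / 2) (T : Finset (Fin n)) :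
    ∫ z, Real.exp (r * excess s γ prior z T) ∂(Measure.pi fun _ : Fin n => gaussianReal 0 1) =
      Real.exp (-(r * penalty n γ prior T.card)) * ((√(1 - 2 * (r * s)))⁻¹) ^ T.card := by
  simp_rw [exp_mul_excess]
  rw [integral_const_mul, integral_fintype_prod_eq_prod
    (f := fun i x => if i ∈ T then Real.exp (r * s * x ^ 2) else 1)]
  congr 1
  have : ∀ i, ∫ x, (if i ∈ T then Real.exp (r * s * x ^ 2) else 1) ∂(gaussianReal 0 1) =
      if i ∈ T then (√(1 - 2 * (r * s)))⁻¹ else 1 := fun i => by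
    by_cases hi : i ∈ T
    · simp [hi, integral_exp_mul_sq_gaussianReal hrs]
    · simp [hi]
  simp_rw [this]
  rw [Finset.prod_ite_mem, Finset.univ_inter, Finset.prod_const]

/-- A prior weight is at most 1, so its r-th power is at most itself. Keeping one factor `prior k`
makes the later sum over k at most 1 − `prior 0`. -/
lemma exp_neg_mul_penalty_le (hγ : 0 < γ) (hp : IsPrior n prior) {k : ℕ} (hk : k ≤ n)
    (hr : 1 ≤ r) :
    Real.exp (-(r * penalty n γ prior k)) ≤ prior k * (n.choose k : ℝ) ^ (-r) := by
  have hC : (0 : ℝ) < n.choose k := by exact_mod_cast Nat.choose_pos hk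
  have hpk := hp.1 k hk
  have hl := Real.log_nonpos hpk.le (hp.le_one hk)
  have ha : 0 ≤ Real.log (1 + γ) := Real.log_nonneg (by linarith)
  rw [Real.rpow_def_of_pos hC]
  conv_rhs => rw [← Real.exp_log hpk]
  rw [← Real.exp_add, Real.exp_le_exp, penalty]
  have : 0 ≤ r * (k * (Real.log (1 + γ) / 2)) := by positivity
  nlinarith

/-- Configurations of a small size `k`: the number of configurations is compensated by the
posterior penalty. -/
lemma sum_integral_exp_mul_excess_le {τ δ : ℝ} (hγ : 0 < γ) (hp : IsPrior n prior) (hn : 0 < n)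
    (hτ : 0 < τ) (hs : (1 + τ) * s ≤ (1 - τ) / 2) (hδ : δ ^ τ * (√τ)⁻¹ ≤ 1)
    {k : ℕ} (hk : k ≤ n) (hkδ : (k : ℝ) ≤ δ * n) :
    ∑ T ∈ Finset.univ.powersetCard k, ∫ z, Real.exp ((1 + τ) * excess s γ prior z T)
      ∂(Measure.pi fun _ : Fin n => gaussianReal 0 1) ≤ prior k := by
  have hC : (0 : ℝ) < n.choose k := by exact_mod_cast Nat.choose_pos hk
  have hn' : (0 : ℝ) < n := by exact_mod_cast hn
  have hpk := hp.1 k hk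
  have hx : (k : ℝ) / n ≤ δ := by rw [div_le_iff₀ hn']; exact hkδ
  have hx0 : 0 ≤ (k : ℝ) / n := by positivity
  have hc : (√(1 - 2 * ((1 + τ) * s)))⁻¹ ≤ (√τ)⁻¹ := by
    have := Real.sqrt_pos.2 hτ
    gcongr
    linarith
  have hterm : ∀ T ∈ (Finset.univ : Finset (Fin n)).powersetCard k,
      ∫ z, Real.exp ((1 + τ) * excess s γ prior z T)
      ∂(Measure.pi fun _ : Fin n => gaussianReal 0 1) ≤
      prior k * (n.choose k : ℝ) ^ (-(1 + τ)) * ((√τ)⁻¹) ^ k := fun T hT => by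
    have hTk : T.card = k := (Finset.mem_powersetCard.1 hT).2
    rw [integral_exp_mul_excess (by linarith), hTk]
    gcongr
    exact exp_neg_mul_penalty_le hγ hp hk (by linarith)
  refine (Finset.sum_le_sum hterm).trans ?_
  rw [Finset.sum_const, Finset.card_powersetCard, Finset.card_univ, Fintype.card_fin,
    nsmul_eq_mul]
  have hchoose : (n.choose k : ℝ)⁻¹ ≤ ((k : ℝ) / n) ^ k := by
    rw [inv_le_iff_one_le_mul₀ hC, div_pow, div_mul_eq_mul_div, le_div_iff₀ (by positivity),
      one_mul, mul_comm]
    exact_mod_cast pow_le_choose_mul_pow hk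
  -- The C(n,k) sets use up one power of the penalty; the remaining C(n,k)^(−τ) ≤ (k/n)^(τk) must
  -- beat the moment factor (√τ)^(−k).
  have h1 : (n.choose k : ℝ) * (n.choose k : ℝ) ^ (-(1 + τ)) = ((n.choose k : ℝ)⁻¹) ^ τ := by
    rw [Real.inv_rpow hC.le, ← Real.rpow_neg hC.le]
    nth_rewrite 1 [← Real.rpow_one (n.choose k : ℝ)]
    rw [← Real.rpow_add hC]; ring_nf
  have h2 : ((n.choose k : ℝ)⁻¹) ^ τ ≤ (δ ^ τ) ^ k := by
    refine (Real.rpow_le_rpow (by positivity) hchoose hτ.le).trans ?_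
    rw [← Real.rpow_natCast, ← Real.rpow_mul hx0, mul_comm, Real.rpow_mul hx0, Real.rpow_natCast]
    gcongr
  calc (n.choose k : ℝ) * (prior k * (n.choose k : ℝ) ^ (-(1 + τ)) * ((√τ)⁻¹) ^ k)
      = prior k * (((n.choose k : ℝ) * (n.choose k : ℝ) ^ (-(1 + τ))) * ((√τ)⁻¹) ^ k) := by ring
    _ ≤ prior k * ((δ ^ τ) ^ k * ((√τ)⁻¹) ^ k) := by rw [h1]; gcongr
    _ = prior k * (δ ^ τ * (√τ)⁻¹) ^ k := by rw [mul_pow]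
    _ ≤ prior k * 1 := by
        have h0 : 0 ≤ δ ^ τ * (√τ)⁻¹ := by have := hx0.trans hx; positivity
        gcongr
        exact pow_le_one₀ h0 hδ
    _ = prior k := mul_one _

/-- The term of T in the expanded product of mixtures carries x^k (1−x)^(n−k), with x = k/n. This is
at least 1/((n+1) C(n,k)), since k is the binomial mode. All sets of one size get the same bound, so
no union over them is needed. -/
lemma exp_excess_le (hp : IsPrior n prior) (hn : 0 < n) (z : Fin n → ℝ)
    (T : Finset (Fin n)) :
    Real.exp (excess s γ prior z T) ≤
      ((n : ℝ) + 1) * ∏ i, tiltedMixture s (Real.log (1 + γ) / 2) ((T.card : ℝ) / n) (z i) := by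
  have hk : T.card ≤ n := by simpa using T.card_le_univ
  set k := T.card with hkdef
  set a := Real.log (1 + γ) / 2 with ha
  have hC : (0 : ℝ) < n.choose k := by exact_mod_cast Nat.choose_pos hk
  have hn' : (0 : ℝ) < n := by exact_mod_cast hn
  set x := (k : ℝ) / n with hx
  have hx0 : 0 ≤ x := by positivity
  have hx1 : x ≤ 1 := by rw [hx, div_le_one hn']; exact_mod_cast hk
  have h1 : Real.exp (excess s γ prior z T) =
      prior k / n.choose k * ∏ i ∈ T, Real.exp (s * z i ^ 2 - a) := by
    rw [← Real.exp_sum, Finset.sum_sub_distrib, ← Finset.mul_sum, excess, penalty]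
    conv_rhs => rw [← Real.exp_log hC, ← Real.exp_log (hp.1 k hk), ← Real.exp_sub, ← Real.exp_add]
    congr 1
    simp [← hkdef, ← ha]; ring
  have h2 : x ^ k * (1 - x) ^ (n - k) * ∏ i ∈ T, Real.exp (s * z i ^ 2 - a) ≤
      ∏ i, tiltedMixture s a x (z i) := by
    rw [← Finset.prod_mul_prod_compl T]
    have e1 : x ^ k * ∏ i ∈ T, Real.exp (s * z i ^ 2 - a) =
        ∏ i ∈ T, (x * Real.exp (s * z i ^ 2 - a)) := by
      rw [Finset.prod_mul_distrib, Finset.prod_const]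
    have e2 : (1 - x) ^ (n - k) = ∏ i ∈ Tᶜ, (1 - x) := by
      rw [Finset.prod_const, Finset.card_compl, Fintype.card_fin]
    calc _ = (∏ i ∈ T, (x * Real.exp (s * z i ^ 2 - a))) * ∏ i ∈ Tᶜ, (1 - x) := by
          rw [← e1, ← e2]; ring
      _ ≤ _ := by
          refine mul_le_mul ?_ ?_ (Finset.prod_nonneg fun _ _ => by linarith)
            (Finset.prod_nonneg fun i _ => tiltedMixture_nonneg hx0 hx1 _)
          · exact Finset.prod_le_prod (fun _ _ => by positivity) fun i _ => by
              unfold tiltedMixture; linarith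
          · refine Finset.prod_le_prod (fun _ _ => by linarith) fun i _ => ?_
            have : 0 ≤ x * Real.exp (s * z i ^ 2 - a) := by positivity
            unfold tiltedMixture; linarith
  have h3 := one_le_choose_mul_pow_mul_pow hn hk
  have h4 : (n.choose k : ℝ)⁻¹ ≤ ((n : ℝ) + 1) * (x ^ k * (1 - x) ^ (n - k)) := by
    rw [inv_le_iff_one_le_mul₀ hC]
    linarith
  have hP : 0 ≤ ∏ i ∈ T, Real.exp (s * z i ^ 2 - a) := Finset.prod_nonneg fun _ _ => (Real.exp_pos _).le
  calc Real.exp (excess s γ prior z T)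
      ≤ 1 * (n.choose k : ℝ)⁻¹ * ∏ i ∈ T, Real.exp (s * z i ^ 2 - a) := by
        rw [h1, div_eq_mul_inv]; gcongr; exact hp.le_one hk
    _ ≤ (((n : ℝ) + 1) * (x ^ k * (1 - x) ^ (n - k))) * ∏ i ∈ T, Real.exp (s * z i ^ 2 - a) := by
        rw [one_mul]; gcongr
    _ ≤ _ := by rw [mul_assoc]; gcongr

/-- From v ≤ 2 exp(v/2). The mixtures themselves need not have mean below 1; their square roots
will. -/
lemma excess_le_mul_prod_sqrt (hp : IsPrior n prior) (hn : 0 < n) (z : Fin n → ℝ)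
    (T : Finset (Fin n)) :
    excess s γ prior z T ≤ 2 * ((n : ℝ) + 1) *
      ∏ i, √(tiltedMixture s (Real.log (1 + γ) / 2) ((T.card : ℝ) / n) (z i)) := by
  have hk : T.card ≤ n := by simpa using T.card_le_univ
  have hn' : (0 : ℝ) < n := by exact_mod_cast hn
  have hx1 : (T.card : ℝ) / n ≤ 1 := by rw [div_le_one hn']; exact_mod_cast hk
  set A := ∏ i, tiltedMixture s (Real.log (1 + γ) / 2) ((T.card : ℝ) / n) (z i) with hA
  have hsq : ∏ i, √(tiltedMixture s (Real.log (1 + γ) / 2) ((T.card : ℝ) / n) (z i)) = √A := by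
    rw [hA, Real.sqrt_prod _ fun i _ => tiltedMixture_nonneg (by positivity) hx1 _]
  have h := Real.sqrt_le_sqrt (exp_excess_le (s := s) (γ := γ) hp hn z T)
  rw [Real.sqrt_mul (by positivity)] at h
  have h2 : √(Real.exp (excess s γ prior z T)) = Real.exp (excess s γ prior z T / 2) :=
    (Real.exp_half _).symm
  have h3 : √((n : ℝ) + 1) ≤ (n : ℝ) + 1 := by
    apply Real.sqrt_le_iff.2; constructor
    · positivity
    · nlinarith
  have h4 := Real.add_one_le_exp (excess s γ prior z T / 2)
  have h5 : √((n : ℝ) + 1) * √A ≤ ((n : ℝ) + 1) * √A := by gcongr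
  rw [hsq]
  linarith

end Excess

/-- The positive part of the excess, maximised over all configurations, is controlled in mean. -/
theorem exists_excess_bound {γmin γmax : ℝ} (hγmin : 0 < γmin) (hγmax : γmin ≤ γmax) :
    ∃ g r : ℝ, 0 < g ∧ 0 < r ∧ r < 1 ∧ ∀ (n : ℕ) (γ : ℝ) (prior : ℕ → ℝ), 0 < n → γmin ≤ γ →
      γ ≤ γmax → IsPrior n prior → ∃ F : (Fin n → ℝ) → ℝ,
        Integrable F (Measure.pi fun _ : Fin n => gaussianReal 0 1) ∧
        (∀ z T, excess (reward γ + g) γ prior z T ≤ F z) ∧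
        ∫ z, F z ∂(Measure.pi fun _ : Fin n => gaussianReal 0 1) ≤
          1 - prior 0 + 2 * ((n : ℝ) + 1) ^ 2 * r ^ n := by
  set G := 1 + γmax with hG
  have hG1 : 1 < G := by linarith
  -- Chosen so that 1 − 2s ≥ 2τ for every admissible γ, whence 1 − 2(1+τ)s ≥ τ and moments of order
  -- 1 + τ stay finite.
  set τ := 1 / (4 * G) with hτdef
  have hτ : 0 < τ := by positivity
  set b := Real.log (1 + γmin) / 2 with hbdef
  have hb : 0 < b := by have := Real.log_pos (by linarith : 1 < 1 + γmin); positivity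
  set q := (gaussianReal 0 1).real (Set.Ioo (-√b) (√b)) * (1 - Real.exp (-(b / 2))) ^ 2 with hq
  have he1 : Real.exp (-(b / 2)) < 1 := Real.exp_lt_one_iff.2 (by linarith)
  have he0 := Real.exp_pos (-(b / 2))
  have hq0 : 0 < q := by
    have := gaussianReal_real_Ioo_pos (Real.sqrt_pos.2 hb)
    have : 0 < 1 - Real.exp (-(b / 2)) := by linarith
    positivity
  have hq1 : q ≤ 1 := by
    rw [hq]
    have : (gaussianReal 0 1).real (Set.Ioo (-√b) (√b)) ≤ 1 := measureReal_le_one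
    have h2 : (1 - Real.exp (-(b / 2))) ^ 2 ≤ 1 := by nlinarith
    exact mul_le_one₀ this (by positivity) h2
  set δ := min 1 ((√τ) ^ (1 / τ)) with hδdef
  have hδ0 : 0 < δ := lt_min one_pos (by positivity)
  have hδ1 : δ ≤ 1 := min_le_left _ _
  have hδτ : δ ^ τ * (√τ)⁻¹ ≤ 1 := by
    rw [← div_eq_mul_inv, div_le_one (by positivity)]
    calc δ ^ τ ≤ ((√τ) ^ (1 / τ)) ^ τ := by gcongr; exact min_le_right _ _
      _ = √τ := by rw [← Real.rpow_mul (by positivity), one_div_mul_cancel hτ.ne', Real.rpow_one]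
  -- For x ≥ δ the second-order gain is at least u, while the tilt g costs u/2; the mean is at most
  -- 1 − u/2.
  set u := δ ^ 2 * q / 8 with hu
  have hu0 : 0 < u := by positivity
  have hδq : δ ^ 2 * q ≤ 1 := by
    have : δ ^ 2 ≤ 1 := pow_le_one₀ hδ0.le hδ1
    exact mul_le_one₀ this hq0.le hq1
  have hu1 : u ≤ 1 / 2 := by rw [hu]; linarith
  refine ⟨u / (2 * G), 1 - u / 2, by positivity, by linarith, by linarith, ?_⟩
  intro n γ prior hn hγ1 hγ2 hp
  set g := u / (2 * G) with hg
  have hg0 : 0 < g := by positivity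
  have hγ : 0 < γ := by linarith
  have hn' : (0 : ℝ) < n := by exact_mod_cast hn
  have hgu : 2 * g * (1 + γ) ≤ u := by
    have : 2 * g * G = u := by rw [hg]; field_simp
    nlinarith
  set s := reward γ + g with hs
  have hs0 : 0 ≤ s := by have := reward_pos hγ; linarith
  have hs2 : s ≤ (1 - 2 * τ) / 2 := by
    have e1 : (1 + γ) * (1 - 2 * s) = 1 - 2 * g * (1 + γ) := by
      rw [hs, reward]; field_simp; ring
    have e2 : (1 + γ) * (2 * τ) ≤ 1 / 2 := by
      have : G * (2 * τ) = 1 / 2 := by rw [hτdef]; field_simp; norm_num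
      rw [← this]; gcongr; linarith
    by_contra hcon
    have : (1 + γ) * (1 - 2 * s) < (1 + γ) * (2 * τ) := by gcongr; linarith
    linarith
  have hsτ : (1 + τ) * s ≤ (1 - τ) / 2 := by
    have : (1 + τ) * s ≤ (1 + τ) * ((1 - 2 * τ) / 2) := by gcongr
    nlinarith
  have hba : b ≤ Real.log (1 + γ) / 2 := by
    rw [hbdef]; gcongr
  set a := Real.log (1 + γ) / 2 with ha
  have hshalf : s < 1 / 2 := by linarith
  -- Index k stands for size k + 1: the empty configuration has excess log π(0) ≤ 0 and is left out,
  -- which produces 1 − π(0) instead of 1.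
  let small := (Finset.range n).filter fun k : ℕ => ((k + 1 : ℕ) : ℝ) ≤ δ * n
  let large := (Finset.range n).filter fun k : ℕ => ¬ ((k + 1 : ℕ) : ℝ) ≤ δ * n
  let f : Finset (Fin n) → (Fin n → ℝ) → ℝ := fun T z => Real.exp ((1 + τ) * excess s γ prior z T)
  let h : ℕ → (Fin n → ℝ) → ℝ := fun k z =>
    2 * ((n : ℝ) + 1) * ∏ i, √(tiltedMixture s a (((k + 1 : ℕ) : ℝ) / n) (z i))
  have hx1 : ∀ k ∈ Finset.range n, ((k + 1 : ℕ) : ℝ) / n ≤ 1 := fun k hk => by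
    rw [div_le_one hn']; exact_mod_cast Finset.mem_range.1 hk
  have hf : ∀ T, Integrable (f T) (Measure.pi fun _ : Fin n => gaussianReal 0 1) := fun T =>
    integrable_exp_mul_excess (by linarith) T
  have hh : ∀ k ∈ Finset.range n, Integrable (h k) (Measure.pi fun _ : Fin n => gaussianReal 0 1) :=
    fun k hk => (Integrable.fintype_prod fun i => integrable_sqrt_tiltedMixture hshalf
      (hb.le.trans hba) (by positivity) (hx1 k hk)).const_mul _
  have hf0 : ∀ T z, 0 ≤ f T z := fun T z => (Real.exp_pos _).le
  have hh0 : ∀ k z, 0 ≤ h k z := fun k z =>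
    mul_nonneg (by positivity) (Finset.prod_nonneg fun _ _ => Real.sqrt_nonneg _)
  have hF1 : ∀ k, Integrable (fun z => ∑ T ∈ Finset.univ.powersetCard k, f T z)
      (Measure.pi fun _ : Fin n => gaussianReal 0 1) := fun k =>
    integrable_finsetSum _ fun T _ => hf T
  have hF2 : Integrable (fun z => ∑ k ∈ small, ∑ T ∈ Finset.univ.powersetCard (k + 1), f T z)
      (Measure.pi fun _ : Fin n => gaussianReal 0 1) :=
    integrable_finsetSum _ fun k _ => hF1 (k + 1)
  have hF3 : Integrable (fun z => ∑ k ∈ large, h k z)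
      (Measure.pi fun _ : Fin n => gaussianReal 0 1) :=
    integrable_finsetSum _ fun k hk => hh k (Finset.mem_filter.1 hk).1
  refine ⟨fun z => ∑ k ∈ small, ∑ T ∈ Finset.univ.powersetCard (k + 1), f T z +
    ∑ k ∈ large, h k z, hF2.add hF3, ?_, ?_⟩
  · intro z T
    have n1 : 0 ≤ ∑ k ∈ small, ∑ T ∈ Finset.univ.powersetCard (k + 1), f T z :=
      Finset.sum_nonneg fun _ _ => Finset.sum_nonneg fun _ _ => hf0 _ _
    have n2 : 0 ≤ ∑ k ∈ large, h k z := Finset.sum_nonneg fun _ _ => hh0 _ _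
    have hTn : T.card ≤ n := by simpa using T.card_le_univ
    rcases Nat.eq_zero_or_pos T.card with h0 | hpos
    · have : excess s γ prior z T ≤ 0 := by
        rw [Finset.card_eq_zero] at h0
        subst h0
        have := Real.log_nonpos (hp.1 0 (Nat.zero_le _)).le (hp.le_one (Nat.zero_le n))
        simpa [excess, penalty] using this
      linarith
    · obtain ⟨k, hk⟩ : ∃ k, T.card = k + 1 := ⟨T.card - 1, by omega⟩
      have hkr : k ∈ Finset.range n := Finset.mem_range.2 (by omega)
      by_cases hsm : ((k + 1 : ℕ) : ℝ) ≤ δ * n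
      · have m1 : f T z ≤ ∑ T ∈ Finset.univ.powersetCard (k + 1), f T z :=
          Finset.single_le_sum (f := fun T => f T z) (fun _ _ => hf0 _ _)
            (Finset.mem_powersetCard.2 ⟨Finset.subset_univ _, hk⟩)
        have m2 : ∑ T ∈ Finset.univ.powersetCard (k + 1), f T z ≤
            ∑ k ∈ small, ∑ T ∈ Finset.univ.powersetCard (k + 1), f T z :=
          Finset.single_le_sum (f := fun k => ∑ T ∈ Finset.univ.powersetCard (k + 1), f T z)
            (fun _ _ => Finset.sum_nonneg fun _ _ => hf0 _ _) (Finset.mem_filter.2 ⟨hkr, hsm⟩)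
        have m3 : excess s γ prior z T ≤ f T z := by
          rcases le_total (excess s γ prior z T) 0 with hneg | hnn
          · exact hneg.trans (hf0 _ _)
          · have := Real.add_one_le_exp ((1 + τ) * excess s γ prior z T)
            simp only [f]
            nlinarith
        linarith
      · have m1 : h k z ≤ ∑ k ∈ large, h k z :=
          Finset.single_le_sum (f := fun k => h k z) (fun _ _ => hh0 _ _)
            (Finset.mem_filter.2 ⟨hkr, hsm⟩)
        have m2 := excess_le_mul_prod_sqrt (s := s) (γ := γ) hp hn z T
        rw [hk] at m2
        have m3 : excess s γ prior z T ≤ h k z := m2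
        linarith
  · rw [integral_add hF2 hF3, integral_finsetSum _ fun k _ => hF1 (k + 1),
      integral_finsetSum _ fun k hk => hh k (Finset.mem_filter.1 hk).1]
    have b1 : ∑ k ∈ small, ∫ z, ∑ T ∈ Finset.univ.powersetCard (k + 1), f T z
        ∂(Measure.pi fun _ : Fin n => gaussianReal 0 1) ≤ 1 - prior 0 := by
      rw [← hp.sum_eq]
      refine (Finset.sum_le_sum (g := fun k => prior (k + 1)) fun k hk => ?_).trans
        (Finset.sum_le_sum_of_subset_of_nonneg (Finset.filter_subset _ _) fun k hk _ =>
          (hp.1 _ (Finset.mem_range.1 hk)).le)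
      rw [integral_finsetSum _ fun T _ => hf T]
      obtain ⟨hk1, hk2⟩ := Finset.mem_filter.1 hk
      exact sum_integral_exp_mul_excess_le hγ hp hn hτ hsτ hδτ (Finset.mem_range.1 hk1) hk2
    have b2 : ∀ k ∈ large, ∫ z, h k z ∂(Measure.pi fun _ : Fin n => gaussianReal 0 1) ≤
        2 * ((n : ℝ) + 1) * (1 - u / 2) ^ n := fun k hk => by
      obtain ⟨hk1, hk2⟩ := Finset.mem_filter.1 hk
      rw [integral_const_mul, integral_fintype_prod_eq_pow
        (f := fun x => √(tiltedMixture s a (((k + 1 : ℕ) : ℝ) / n) x)), Fintype.card_fin]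
      gcongr
      · refine (integral_sqrt_tiltedMixture_le hb.le hγ hu1 hgu hg0.le hba hq (by positivity)
          (hx1 k hk1)).trans ?_
        have hxδ : δ ≤ ((k + 1 : ℕ) : ℝ) / n := by
          rw [le_div_iff₀ hn']; exact (not_le.1 hk2).le
        have : δ ^ 2 * q ≤ (((k + 1 : ℕ) : ℝ) / n) ^ 2 * q := by gcongr
        linarith
    have b3 : ∑ k ∈ large, ∫ z, h k z ∂(Measure.pi fun _ : Fin n => gaussianReal 0 1) ≤
        2 * ((n : ℝ) + 1) ^ 2 * (1 - u / 2) ^ n := by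
      refine (Finset.sum_le_card_nsmul _ _ _ b2).trans ?_
      rw [nsmul_eq_mul]
      have hc : (large.card : ℝ) ≤ (n : ℝ) + 1 := by
        have : large.card ≤ n := (Finset.card_filter_le _ _).trans (by simp)
        have : (large.card : ℝ) ≤ n := by exact_mod_cast this
        linarith
      have : 0 ≤ 2 * ((n : ℝ) + 1) * (1 - u / 2) ^ n := by
        have : 0 ≤ 1 - u / 2 := by linarith
        positivity
      calc _ ≤ ((n : ℝ) + 1) * (2 * ((n : ℝ) + 1) * (1 - u / 2) ^ n) := by gcongr
        _ = _ := by ring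
    linarith

/-! ### Oracle inequality for the risk. -/

section Oracle

lemma penalty_nonneg {n : ℕ} {γ : ℝ} {prior : ℕ → ℝ} (hγ : 0 < γ) (hp : IsPrior n prior) {k : ℕ}
    (hk : k ≤ n) : 0 ≤ penalty n γ prior k := by
  have h1 : (1 : ℝ) ≤ n.choose k := by exact_mod_cast Nat.choose_pos hk
  have h2 := Real.log_nonneg h1
  have h3 := Real.log_nonpos (hp.1 k hk).le (hp.le_one hk)
  have h4 : 0 ≤ Real.log (1 + γ) := Real.log_nonneg (by linarith)
  have h5 : 0 ≤ (k : ℝ) * (Real.log (1 + γ) / 2) := by positivity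
  unfold penalty; linarith

lemma reward_mono {γ γ' : ℝ} (hγ : 0 < γ) (h : γ ≤ γ') : reward γ ≤ reward γ' := by
  unfold reward
  rw [div_le_div_iff₀ (by positivity) (by linarith)]
  nlinarith

lemma reward_le_half {γ : ℝ} (hγ : 0 < γ) : reward γ ≤ 1 / 2 := by
  unfold reward
  rw [div_le_div_iff₀ (by positivity) (by norm_num)]
  linarith

lemma ae_abs_ne_abs {n : ℕ} {σ : ℝ} (hσ : 0 < σ) (μ : Fin n → ℝ) :
    ∀ᵐ z ∂(Measure.pi fun _ : Fin n => gaussianReal 0 1),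
      ∀ i j, i ≠ j → |μ i + σ * z i| ≠ |μ j + σ * z j| := by
  rw [ae_all_iff]; intro i
  rw [ae_all_iff]; intro j
  by_cases hij : i = j
  · exact ae_of_all _ fun z h => absurd hij h
  filter_upwards [ae_ne_add_mul n ((μ j - μ i) / σ) 1 hij,
    ae_ne_add_mul n ((-μ j - μ i) / σ) (-1) hij] with z h1 h2 _ h
  rcases abs_eq_abs.1 h with h | h
  · exact h1 (by field_simp; linarith)
  · exact h2 (by field_simp; linarith)

lemma integrable_sum_sq {n : ℕ} (T : Finset (Fin n)) :
    Integrable (fun z : Fin n → ℝ => ∑ i ∈ T, z i ^ 2)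
      (Measure.pi fun _ : Fin n => gaussianReal 0 1) :=
  integrable_finsetSum _ fun i _ =>
    integrable_comp_eval (μ := fun _ : Fin n => gaussianReal 0 1) (i := i)
      integrable_sq_gaussianReal

lemma integral_sum_sq {n : ℕ} (T : Finset (Fin n)) :
    ∫ z : Fin n → ℝ, ∑ i ∈ T, z i ^ 2 ∂(Measure.pi fun _ : Fin n => gaussianReal 0 1) = T.card := by
  rw [integral_finsetSum _ fun i _ => integrable_comp_eval (μ := fun _ : Fin n => gaussianReal 0 1)
    (i := i) integrable_sq_gaussianReal]
  have : ∀ i : Fin n, ∫ z : Fin n → ℝ, z i ^ 2 ∂(Measure.pi fun _ : Fin n => gaussianReal 0 1) = 1 :=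
    fun i => by
      rw [← integral_sq_gaussianReal]
      exact integral_comp_eval (μ := fun _ : Fin n => gaussianReal 0 1) (i := i)
        (f := fun x : ℝ => x ^ 2) (by fun_prop)
  simp [this]

/-- The risk is bounded by the penalised error of any competing configuration `T`, up to the mean
excess of the noise. -/
theorem exists_oracle_bound {γmin γmax : ℝ} (hγmin : 0 < γmin) (hγmax : γmin ≤ γmax) :
    ∃ C r : ℝ, 0 < C ∧ 0 < r ∧ r < 1 ∧ ∀ (n : ℕ) (σ γ : ℝ) (prior : ℕ → ℝ)
      (est : (Fin n → ℝ) → Fin n → ℝ) (μ : Fin n → ℝ) (T : Finset (Fin n)), 0 < n → 0 < σ →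
      γmin ≤ γ → γ ≤ γmax → IsPrior n prior → IsMAPEstimator n σ γ prior est →
      risk σ est μ ≤ ENNReal.ofReal (σ ^ 2 * (C * (penalty n γ prior T.card + T.card +
        ∑ i ∈ Tᶜ, (μ i / σ) ^ 2 + (1 - prior 0) + ((n : ℝ) + 1) ^ 2 * r ^ n))) := by
  obtain ⟨g, r, hg, hr0, hr1, H⟩ := exists_excess_bound hγmin hγmax
  have hrm := reward_pos hγmin
  set A := 2 / g + 2 / reward γmin with hA
  set B := 1 / 2 + 2 * (1 / 2) ^ 2 / g with hB
  have hA0 : 0 < A := by positivity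
  have hB0 : 0 < B := by positivity
  refine ⟨2 * A + A * B + 4, r, by positivity, hr0, hr1, ?_⟩
  intro n σ γ prior est μ T hn hσ hγ1 hγ2 hp hest
  obtain ⟨F, hFi, hF, hFint⟩ := H n γ prior hn hγ1 hγ2 hp
  have hγ : 0 < γ := by linarith
  set a := reward γ with ha
  have ha0 : 0 < a := reward_pos hγ
  set P := penalty n γ prior T.card with hP
  have hP0 : 0 ≤ P := penalty_nonneg hγ hp (by simpa using T.card_le_univ)
  set M := ∑ i ∈ Tᶜ, (μ i / σ) ^ 2 with hM
  have hM0 : 0 ≤ M := Finset.sum_nonneg fun _ _ => sq_nonneg _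
  set h : (Fin n → ℝ) → ℝ := fun z => σ ^ 2 * ((2 / g + 2 / a) * (P + (a + 2 * a ^ 2 / g) * M + F z) +
    3 * ∑ i ∈ T, z i ^ 2 + M) with hh
  have hae : ∀ᵐ z ∂(Measure.pi fun _ : Fin n => gaussianReal 0 1),
      ∑ i, (est (fun j => μ j + σ * z j) i - μ i) ^ 2 ≤ h z := by
    filter_upwards [ae_abs_ne_abs hσ μ] with z hz
    obtain ⟨S, hS, hSe⟩ := hest fun j => μ j + σ * z j
    have e0 : ∀ i, (μ i + σ * z i) / σ = μ i / σ + z i := fun i => by field_simp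
    have hmax := hS.le hγ hp.1 T
    simp only [e0] at hmax
    have hl := loss_le_of_isMaximal ha0 hg hmax
    -- Kept coordinates err by their noise, the others by their mean.
    have e1 : ∑ i, (est (fun j => μ j + σ * z j) i - μ i) ^ 2 =
        σ ^ 2 * (∑ i ∈ S, z i ^ 2 + ∑ i ∈ Sᶜ, (μ i / σ) ^ 2) := by
      rw [hSe, ← Finset.sum_add_sum_compl S, mul_add, Finset.mul_sum, Finset.mul_sum]
      congr 1
      · refine Finset.sum_congr rfl fun i hi => ?_
        rw [hS.hardThreshold_eq hσ hγ hp.1 hz, if_pos hi]; ring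
      · refine Finset.sum_congr rfl fun i hi => ?_
        rw [hS.hardThreshold_eq hσ hγ hp.1 hz, if_neg (Finset.mem_compl.1 hi)]
        field_simp; ring
    rw [e1, hh]
    have := hF z S
    refine mul_le_mul_of_nonneg_left (hl.trans ?_) (sq_nonneg σ)
    gcongr
  have hi : Integrable h (Measure.pi fun _ : Fin n => gaussianReal 0 1) :=
    (((((integrable_const _).add hFi).const_mul _).add
      ((integrable_sum_sq T).const_mul 3)).add (integrable_const M)).const_mul _
  have hint : ∫ z, h z ∂(Measure.pi fun _ : Fin n => gaussianReal 0 1) =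
      σ ^ 2 * ((2 / g + 2 / a) * (P + (a + 2 * a ^ 2 / g) * M +
        ∫ z, F z ∂(Measure.pi fun _ : Fin n => gaussianReal 0 1)) + 3 * T.card + M) := by
    simp only [hh]
    rw [integral_const_mul, integral_add _ (integrable_const M), integral_add,
      integral_const_mul, integral_const_mul, integral_sum_sq,
      integral_add (integrable_const _) hFi]
    · simp
    · exact ((integrable_const _).add hFi).const_mul _
    · exact (integrable_sum_sq T).const_mul 3
    · exact (((integrable_const _).add hFi).const_mul _).add ((integrable_sum_sq T).const_mul 3)
  -- Ties may make `est` non-measurable; the almost sure comparison with the integrable `h` does not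
  -- need its measurability.
  have hrisk : risk σ est μ ≤
      ENNReal.ofReal (∫ z, h z ∂(Measure.pi fun _ : Fin n => gaussianReal 0 1)) := by
    rw [ofReal_integral_eq_lintegral_ofReal hi]
    · exact lintegral_mono_ae (hae.mono fun z hz => ENNReal.ofReal_le_ofReal hz)
    · exact hae.mono fun z hz => (Finset.sum_nonneg fun _ _ => sq_nonneg _).trans hz
  refine hrisk.trans (ENNReal.ofReal_le_ofReal ?_)
  rw [hint]
  refine mul_le_mul_of_nonneg_left ?_ (sq_nonneg σ)
  have hA' : 2 / g + 2 / a ≤ A := by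
    rw [hA]; have := reward_mono hγmin hγ1; gcongr
  have hB' : a + 2 * a ^ 2 / g ≤ B := by
    have := reward_le_half hγ
    rw [hB]; gcongr
  set D := ((n : ℝ) + 1) ^ 2 * r ^ n with hD
  have hD0 : 0 ≤ D := by positivity
  have hp0 : 0 ≤ 1 - prior 0 := by have := hp.le_one (Nat.zero_le n); linarith
  have hT0 : (0 : ℝ) ≤ T.card := by positivity
  calc _ ≤ (2 / g + 2 / a) * (P + B * M + (1 - prior 0 + 2 * D)) + 3 * T.card + M := by
        gcongr; rw [hD]; linarith
    _ ≤ A * (P + B * M + (1 - prior 0 + 2 * D)) + 3 * T.card + M := by gcongr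
    _ ≤ _ := by
      have hAB : 0 ≤ A * B := by positivity
      have x1 := mul_nonneg hAB hP0
      have x2 := mul_nonneg hAB hT0
      have x3 := mul_nonneg hAB hp0
      have x4 := mul_nonneg hAB hD0
      have y1 := mul_nonneg hA0.le hP0
      have y2 := mul_nonneg hA0.le hT0
      have y3 := mul_nonneg hA0.le hp0
      have y4 := mul_nonneg hA0.le hD0
      have y5 := mul_nonneg hA0.le hM0
      linarith

end Oracle

/-! ### Squared means over l_p-balls. -/

section Balls

variable {n : ℕ} {σ η p : ℝ} {μ : Fin n → ℝ}

lemma sum_abs_rpow_le_of_mem_lpBall (hσ : 0 < σ) (hη : 0 ≤ η) (hp : 0 < p)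
    (hμ : μ ∈ lpBall n σ (ENNReal.ofReal p) η) : ∑ i, |μ i / σ| ^ p ≤ n * η ^ p := by
  have hpt : (ENNReal.ofReal p).toReal = p := ENNReal.toReal_ofReal hp.le
  rw [lpBall, Set.mem_ofPred_eq, PiLp.norm_eq_sum (by rw [hpt]; exact hp), ENNReal.toReal_inv, hpt]
    at hμ
  have h0 : 0 ≤ ∑ i, |μ i| ^ p := Finset.sum_nonneg fun _ _ => Real.rpow_nonneg (abs_nonneg _) _
  have h1 := Real.rpow_le_rpow (Real.rpow_nonneg h0 _) hμ hp.le
  rw [← Real.rpow_mul h0, one_div_mul_cancel hp.ne', Real.rpow_one,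
    Real.mul_rpow (by positivity) hη, Real.mul_rpow (by positivity) hσ.le,
    ← Real.rpow_mul (by positivity), inv_mul_cancel₀ hp.ne', Real.rpow_one] at h1
  have h2 : ∑ i, |μ i / σ| ^ p = (∑ i, |μ i| ^ p) / σ ^ p := by
    rw [Finset.sum_div]
    refine Finset.sum_congr rfl fun i _ => ?_
    rw [abs_div, abs_of_pos hσ, Real.div_rpow (abs_nonneg _) hσ.le]
  rw [h2, div_le_iff₀ (by positivity)]
  calc _ ≤ _ := h1
    _ = _ := by ring

lemma sq_eq_abs_rpow_mul (x : ℝ) : x ^ 2 = |x| ^ p * |x| ^ (2 - p) := by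
  rw [← Real.rpow_add' (abs_nonneg x) (by norm_num)]
  norm_num

/-- For p < 2 a single spike is extremal: each normalised mean is at most D^(1/p), which pulls 2 − p
powers out of the square. -/
lemma sum_sq_le_of_mem_lpBall_of_lt_two (hσ : 0 < σ) (hη : 0 ≤ η) (hp : 0 < p)
    (hp2 : p < 2) (hμ : μ ∈ lpBall n σ (ENNReal.ofReal p) η) :
    ∑ i, (μ i / σ) ^ 2 ≤ (n : ℝ) ^ (2 / p) * η ^ 2 := by
  have h := sum_abs_rpow_le_of_mem_lpBall hσ hη hp hμ
  set D := (n : ℝ) * η ^ p with hD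
  have hD0 : 0 ≤ D := by positivity
  have h1 : ∀ i, |μ i / σ| ≤ D ^ (1 / p) := fun i => by
    have : |μ i / σ| ^ p ≤ D := (Finset.single_le_sum (f := fun i => |μ i / σ| ^ p)
      (fun _ _ => Real.rpow_nonneg (abs_nonneg _) _) (Finset.mem_univ i)).trans h
    have := Real.rpow_le_rpow (by positivity) this (by positivity : 0 ≤ 1 / p)
    rwa [← Real.rpow_mul (abs_nonneg _), mul_one_div_cancel hp.ne', Real.rpow_one] at this
  have h2 : D * (D ^ (1 / p)) ^ (2 - p) = (n : ℝ) ^ (2 / p) * η ^ 2 := by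
    have e : 1 + 1 / p * (2 - p) = 2 / p := by field_simp; ring
    nth_rewrite 1 [← Real.rpow_one D]
    rw [← Real.rpow_mul hD0, ← Real.rpow_add' hD0 (by rw [e]; positivity), e, hD,
      Real.mul_rpow (by positivity) (by positivity), ← Real.rpow_mul hη]
    congr 1
    rw [mul_div_cancel₀ _ hp.ne']
    norm_num
  rw [← h2]
  calc ∑ i, (μ i / σ) ^ 2 ≤ ∑ i, |μ i / σ| ^ p * (D ^ (1 / p)) ^ (2 - p) := by
        refine Finset.sum_le_sum fun i _ => ?_
        rw [sq_eq_abs_rpow_mul (p := p)]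
        gcongr
        exact h1 i
    _ = (∑ i, |μ i / σ| ^ p) * (D ^ (1 / p)) ^ (2 - p) := by rw [Finset.sum_mul]
    _ ≤ _ := by gcongr

/-- For finite p this is the power mean inequality of exponent p/2 ≥ 1; for p = ∞ each coordinate is
bounded by η. -/
lemma sum_sq_le_of_mem_lpBall_of_two_le {p : ℝ≥0∞} (hn : 0 < n) (hσ : 0 < σ) (hη : 0 ≤ η)
    (hp : 2 ≤ p) (hμ : μ ∈ lpBall n σ p η) :
    ∑ i, (μ i / σ) ^ 2 ≤ n * η ^ 2 := by
  rcases eq_or_ne p ⊤ with rfl | hptop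
  · have h1 : ∀ i, |μ i / σ| ≤ η := fun i => by
      rw [lpBall, Set.mem_ofPred_eq, PiLp.norm_eq_ciSup] at hμ
      have h2 := (le_ciSup (Set.finite_range fun i : Fin n =>
        ‖(WithLp.toLp ⊤ μ : PiLp ⊤ fun _ : Fin n => ℝ) i‖).bddAbove i).trans hμ
      simp at h2
      rw [abs_div, abs_of_pos hσ, div_le_iff₀ hσ]
      linarith
    calc ∑ i, (μ i / σ) ^ 2 ≤ ∑ _i : Fin n, η ^ 2 := Finset.sum_le_sum fun i _ => by
          rw [← sq_abs]; have := h1 i; gcongr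
      _ = _ := by simp
  · set q := p.toReal with hq
    have hq2 : 2 ≤ q := by
      have := ENNReal.toReal_mono hptop hp
      simpa using this
    have hpq : p = ENNReal.ofReal q := (ENNReal.ofReal_toReal hptop).symm
    rw [hpq] at hμ
    have h := sum_abs_rpow_le_of_mem_lpBall hσ hη (by linarith) hμ
    have h0 : 0 ≤ ∑ i, (μ i / σ) ^ 2 := Finset.sum_nonneg fun _ _ => sq_nonneg _
    have h1 := Real.rpow_sum_le_const_mul_sum_rpow_of_nonneg (s := Finset.univ)
      (f := fun i => (μ i / σ) ^ 2) (p := q / 2) (by linarith) (fun i _ => sq_nonneg _)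
    have h2 : ∀ i, ((μ i / σ) ^ 2) ^ (q / 2) = |μ i / σ| ^ q := fun i => by
      rw [← sq_abs, ← Real.rpow_natCast, ← Real.rpow_mul (abs_nonneg _)]
      congr 1; push_cast; ring
    simp only [h2, Finset.card_univ, Fintype.card_fin] at h1
    have hn' : (0 : ℝ) < n := by exact_mod_cast hn
    have h3 : (∑ i, (μ i / σ) ^ 2) ^ (q / 2) ≤ (n * η ^ 2) ^ (q / 2) := by
      calc _ ≤ (n : ℝ) ^ (q / 2 - 1) * (n * η ^ q) := h1.trans (by gcongr)
        _ = (n : ℝ) ^ (q / 2) * η ^ q := by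
          rw [← mul_assoc, Real.rpow_sub_one hn'.ne', div_mul_cancel₀ _ hn'.ne']
        _ = _ := by
          rw [Real.mul_rpow hn'.le (by positivity), ← Real.rpow_natCast η 2, ← Real.rpow_mul hη]
          congr 2; push_cast; ring
    exact (Real.rpow_le_rpow_iff h0 (by positivity) (by linarith)).1 h3

/-- The configuration of the means exceeding the level `s`, when the `p`-th moment is bounded. -/
lemma exists_config {m : Fin n → ℝ} {D s : ℝ} (hn : 0 < n) (hs : 0 < s) (hp : 0 < p) (hp2 : p < 2)
    (hm : ∑ i, |m i| ^ p ≤ D) (hD : 1 ≤ D * s ^ (-p)) :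
    ∃ T : Finset (Fin n), 1 ≤ T.card ∧ (T.card : ℝ) ≤ D * s ^ (-p) ∧
      ∑ i ∈ Tᶜ, m i ^ 2 ≤ D * s ^ (2 - p) := by
  classical
  set U := Finset.univ.filter fun i => s < |m i| with hU
  have hUcard : (U.card : ℝ) ≤ D * s ^ (-p) := by
    rw [Real.rpow_neg hs.le, ← div_eq_mul_inv, le_div_iff₀ (by positivity)]
    calc (U.card : ℝ) * s ^ p = ∑ i ∈ U, s ^ p := by simp
      _ ≤ ∑ i ∈ U, |m i| ^ p := Finset.sum_le_sum fun i hi => by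
          have := (Finset.mem_filter.1 hi).2
          gcongr
      _ ≤ ∑ i, |m i| ^ p := Finset.sum_le_sum_of_subset_of_nonneg (Finset.subset_univ _)
          fun _ _ _ => by positivity
      _ ≤ D := hm
  have hout : ∀ T : Finset (Fin n), U ⊆ T → ∑ i ∈ Tᶜ, m i ^ 2 ≤ D * s ^ (2 - p) := fun T hT => by
    calc ∑ i ∈ Tᶜ, m i ^ 2 ≤ ∑ i ∈ Tᶜ, |m i| ^ p * s ^ (2 - p) := by
          refine Finset.sum_le_sum fun i hi => ?_
          have : |m i| ≤ s := by
            by_contra hc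
            exact Finset.mem_compl.1 hi (hT (Finset.mem_filter.2 ⟨Finset.mem_univ _, not_le.1 hc⟩))
          rw [sq_eq_abs_rpow_mul (p := p)]
          gcongr
      _ = (∑ i ∈ Tᶜ, |m i| ^ p) * s ^ (2 - p) := by rw [Finset.sum_mul]
      _ ≤ D * s ^ (2 - p) := by
          gcongr
          exact (Finset.sum_le_sum_of_subset_of_nonneg (Finset.subset_univ _)
            fun _ _ _ => by positivity).trans hm
  rcases Nat.eq_zero_or_pos U.card with h0 | hpos
  -- If no mean exceeds s, a singleton is used, because the prior is controlled only from size 1 on;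
  -- `hD` leaves room for it.
  · refine ⟨{⟨0, hn⟩}, by simp, by simpa using hD, hout _ ?_⟩
    rw [Finset.card_eq_zero.1 h0]; exact Finset.empty_subset _
  · exact ⟨U, hpos, hUcard, hout U subset_rfl⟩

end Balls

/-! ### Choice of the competitor and resulting rates. -/

section Rates

lemma exists_geometric_le {r : ℝ} (hr0 : 0 < r) (hr1 : r < 1) (β : ℝ) :
    ∃ N : ℕ, 2 ≤ N ∧ ∀ n : ℕ, N ≤ n →
      ((n : ℝ) + 1) ^ 2 * r ^ n ≤ (n : ℝ) ^ (-β) * Real.log n := by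
  obtain ⟨b, hb⟩ := exists_nat_ge β
  have h := tendsto_pow_const_mul_const_pow_of_abs_lt_one (b + 2) (abs_lt.2 ⟨by linarith, hr1⟩)
  have hpos : (0 : ℝ) < Real.log 2 / 4 := by have := Real.log_pos one_lt_two; positivity
  obtain ⟨N, hN⟩ := Filter.eventually_atTop.1 (h.eventually_lt_const hpos)
  refine ⟨max N 2, le_max_right _ _, fun n hn => ?_⟩
  have hn2 : 2 ≤ n := (le_max_right _ _).trans hn
  have hn2' : (2 : ℝ) ≤ n := by exact_mod_cast hn2
  have h1 := hN n ((le_max_left _ _).trans hn)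
  have h2 : Real.log 2 ≤ Real.log n := Real.log_le_log (by norm_num) hn2'
  have h3 : (n : ℝ) ^ (-(b : ℝ)) ≤ (n : ℝ) ^ (-β) :=
    Real.rpow_le_rpow_of_exponent_le (by linarith) (by linarith)
  have h4 : ((n : ℝ) + 1) ^ 2 * r ^ n ≤ (n : ℝ) ^ (-(b : ℝ)) * Real.log 2 := by
    rw [Real.rpow_neg (by positivity), Real.rpow_natCast, inv_mul_eq_div,
      le_div_iff₀ (by positivity)]
    calc ((n : ℝ) + 1) ^ 2 * r ^ n * (n : ℝ) ^ b ≤ (2 * n) ^ 2 * r ^ n * (n : ℝ) ^ b := by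
          gcongr; linarith
      _ = 4 * ((n : ℝ) ^ (b + 2) * r ^ n) := by ring
      _ ≤ _ := by linarith
  refine h4.trans ?_
  have := Real.log_pos one_lt_two
  gcongr

variable {γmin γmax : ℝ}

/-- Bound for a prior charging the null configuration. -/
theorem exists_risk_bound_of_prior_zero (hγmin : 0 < γmin) (hγmax : γmin ≤ γmax) {β c₁ : ℝ}
    (hc₁ : 0 < c₁) :
    ∃ (C : ℝ) (N : ℕ), 0 < C ∧ 2 ≤ N ∧ ∀ n : ℕ, N ≤ n →
      ∀ (σ γ : ℝ) (prior : ℕ → ℝ) (est : (Fin n → ℝ) → Fin n → ℝ) (μ : Fin n → ℝ),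
        0 < σ → γmin ≤ γ → γ ≤ γmax → IsPrior n prior → IsMAPEstimator n σ γ prior est →
        (n : ℝ) ^ (-(c₁ * (n : ℝ) ^ (-β))) ≤ prior 0 →
        risk σ est μ ≤ ENNReal.ofReal
          (σ ^ 2 * (C * (∑ i, (μ i / σ) ^ 2 + (n : ℝ) ^ (-β) * Real.log n))) := by
  obtain ⟨C, r, hC, hr0, hr1, H⟩ := exists_oracle_bound hγmin hγmax
  obtain ⟨N, hN2, hN⟩ := exists_geometric_le hr0 hr1 β
  refine ⟨C * (2 * c₁ + 1), N, by positivity, hN2, ?_⟩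
  intro n hn σ γ prior est μ hσ h1 h2 hp hest h0
  have hn0 : 0 < n := by omega
  have hn1 : (1 : ℝ) ≤ n := by exact_mod_cast hn0
  refine (H n σ γ prior est μ ∅ hn0 hσ h1 h2 hp hest).trans (ENNReal.ofReal_le_ofReal ?_)
  refine mul_le_mul_of_nonneg_left ?_ (sq_nonneg σ)
  have hprior0 := hp.1 0 (Nat.zero_le n)
  have hlog : -Real.log (prior 0) ≤ c₁ * ((n : ℝ) ^ (-β) * Real.log n) := by
    have := Real.log_le_log (by positivity) h0
    rw [Real.log_rpow (by positivity)] at this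
    linarith
  -- The mean excess is thus no larger than the penalty of the empty competitor.
  have hone : 1 - prior 0 ≤ -Real.log (prior 0) := by
    have := Real.log_le_sub_one_of_pos hprior0
    linarith
  have hgeo := hN n hn
  have hM : 0 ≤ ∑ i, (μ i / σ) ^ 2 := Finset.sum_nonneg fun _ _ => sq_nonneg _
  rw [mul_assoc]
  refine mul_le_mul_of_nonneg_left ?_ hC.le
  simp only [Finset.card_empty, penalty, Nat.choose_zero_right, Nat.cast_one, Real.log_one,
    Finset.compl_empty, Nat.cast_zero, zero_mul]
  nlinarith

/-- The full competitor has no bias, and its penalty −log π(n) + n log(1+γ)/2 is linear in n, as is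
its noise. -/
theorem exists_risk_bound_of_prior_top (hγmin : 0 < γmin) (hγmax : γmin ≤ γmax) {c₀ : ℝ}
    (hc₀ : 0 < c₀) :
    ∃ (C : ℝ) (N : ℕ), 0 < C ∧ ∀ n : ℕ, N ≤ n →
      ∀ (σ γ : ℝ) (prior : ℕ → ℝ) (est : (Fin n → ℝ) → Fin n → ℝ) (μ : Fin n → ℝ),
        0 < σ → γmin ≤ γ → γ ≤ γmax → IsPrior n prior → IsMAPEstimator n σ γ prior est →
        Real.exp (-(c₀ * n)) ≤ prior n → risk σ est μ ≤ ENNReal.ofReal (C * (n * σ ^ 2)) := by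
  obtain ⟨C, r, hC, hr0, hr1, H⟩ := exists_oracle_bound hγmin hγmax
  obtain ⟨N, hN2, hN⟩ := exists_geometric_le hr0 hr1 0
  have hγm : 0 < γmax := by linarith
  refine ⟨C * (c₀ + γmax + 3), N, by positivity, ?_⟩
  intro n hn σ γ prior est μ hσ h1 h2 hp hest h0
  have hn0 : 0 < n := by omega
  have hn1 : (1 : ℝ) ≤ n := by exact_mod_cast hn0
  refine (H n σ γ prior est μ Finset.univ hn0 hσ h1 h2 hp hest).trans (ENNReal.ofReal_le_ofReal ?_)
  have hlog : -Real.log (prior n) ≤ c₀ * n := by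
    have := Real.log_le_log (Real.exp_pos _) h0
    rw [Real.log_exp] at this
    linarith
  have hone := hp.1 0 (Nat.zero_le n)
  have hgeo := hN n hn
  rw [neg_zero, Real.rpow_zero, one_mul] at hgeo
  have hlogn := Real.log_le_sub_one_of_pos (by linarith : (0 : ℝ) < n)
  have hlogγ := Real.log_le_sub_one_of_pos (by linarith : (0 : ℝ) < 1 + γ)
  have hkγ : (n : ℝ) * (Real.log (1 + γ) / 2) ≤ n * γmax := by gcongr; linarith
  have key : penalty n γ prior (Finset.univ : Finset (Fin n)).card +
      (Finset.univ : Finset (Fin n)).card + ∑ i ∈ (Finset.univ : Finset (Fin n))ᶜ, (μ i / σ) ^ 2 +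
      (1 - prior 0) + ((n : ℝ) + 1) ^ 2 * r ^ n ≤ (c₀ + γmax + 3) * n := by
    simp only [Finset.card_univ, Fintype.card_fin, Finset.compl_univ, Finset.sum_empty, penalty,
      Nat.choose_self, Nat.cast_one, Real.log_one]
    linarith
  calc _ ≤ σ ^ 2 * (C * ((c₀ + γmax + 3) * n)) := by gcongr
    _ = _ := by ring

/-- Bound over small `l_p`-balls, `p < 2`, for a prior charging all sparse configurations. -/
theorem exists_risk_bound_of_sparse (hγmin : 0 < γmin) (hγmax : γmin ≤ γmax) {p c₂ : ℝ}
    (hp0 : 0 < p) (hp2 : p < 2) (hc₂ : 0 < c₂) :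
    ∃ (C : ℝ) (N : ℕ), 0 < C ∧ ∀ n : ℕ, N ≤ n →
      ∀ (σ γ η α : ℝ) (prior : ℕ → ℝ) (est : (Fin n → ℝ) → Fin n → ℝ) (μ : Fin n → ℝ),
        0 < σ → γmin ≤ γ → γ ≤ γmax → 0 ≤ η → IsPrior n prior → IsMAPEstimator n σ γ prior est →
        α ≤ Real.exp (-(8 * (γ + 3 / 4) ^ 2)) →
        (∀ κ : ℕ, 1 ≤ κ → (κ : ℝ) ≤ α * n → ((κ : ℝ) / n) ^ (c₂ * κ) ≤ prior κ) →
        (n : ℝ)⁻¹ * (2 * Real.log n) ^ (p / 2) ≤ η ^ p → η ^ p ≤ α →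
        μ ∈ lpBall n σ (ENNReal.ofReal p) η →
        risk σ est μ ≤ ENNReal.ofReal
          (C * (σ ^ 2 * n * η ^ p * (2 * Real.log (η ^ (-p))) ^ (1 - p / 2))) := by
  obtain ⟨C, r, hC, hr0, hr1, H⟩ := exists_oracle_bound hγmin hγmax
  obtain ⟨N, hN2, hN⟩ := exists_geometric_le hr0 hr1 1
  have hγm : 0 < γmax := by linarith
  refine ⟨C * (2 * (1 + c₂) + γmax + 5), N, by positivity, ?_⟩
  intro n hn σ γ η α prior est μ hσ h1 h2 hη hp hest hα hprior hηlow hηα hμ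
  have hn0 : 0 < n := by omega
  have hn2 : (2 : ℝ) ≤ n := by exact_mod_cast hN2.trans hn
  have hγ : 0 < γ := by linarith
  rw [Real.rpow_neg hη]
  set E := η ^ p with hE
  have hlogn : 1 ≤ 2 * Real.log n := by
    have := Real.log_le_log (by norm_num) hn2
    have := Real.log_two_gt_d9
    linarith
  have hE0 : 0 < E := lt_of_lt_of_le (by positivity) hηlow
  set w := 2 * Real.log E⁻¹ with hw
  -- The ceiling on α gives w ≥ 16(γ + 3/4)² ≥ 9; below, only w ≥ 1 matters.
  have hw9 : 9 ≤ w := by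
    have h3 := Real.log_le_log hE0 (hηα.trans hα)
    rw [Real.log_exp] at h3
    rw [hw, Real.log_inv]
    nlinarith
  have hnE : (n : ℝ)⁻¹ ≤ E := by
    refine le_trans ?_ hηlow
    exact le_mul_of_one_le_right (by positivity) (Real.one_le_rpow hlogn (by positivity))
  have hwn : w ≤ 2 * Real.log n := by
    rw [hw]
    gcongr
    exact inv_le_of_inv_le₀ (by positivity) hnE
  have hw0 : 0 < w := by linarith
  set s := √w with hs
  have hs0 : 0 < s := Real.sqrt_pos.2 hw0
  have hspow : ∀ t : ℝ, s ^ t = w ^ (t / 2) := fun t => by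
    rw [hs, Real.sqrt_eq_rpow, ← Real.rpow_mul hw0.le]; congr 1; ring
  -- K bounds the number of means above the level s = √w, and K w is the target rate. The lower
  -- limit on η and w ≤ 2 log n give K ≥ 1.
  set K := n * E * s ^ (-p) with hK
  have hK1 : 1 ≤ K := by
    rw [hK, Real.rpow_neg hs0.le, ← div_eq_mul_inv, le_div_iff₀ (by positivity), one_mul, hspow]
    have h3 : w ^ (p / 2) ≤ (2 * Real.log n) ^ (p / 2) := by gcongr
    rw [inv_mul_le_iff₀ (by positivity)] at hηlow
    linarith
  have hKw : n * E * s ^ (2 - p) = K * w := by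
    rw [hK, mul_assoc, mul_assoc, mul_assoc]
    congr 2
    have : w = s ^ (2 : ℝ) := by rw [hspow]; norm_num
    rw [this, ← Real.rpow_add hs0]; congr 1; ring
  have hs1 : s ^ (-p) ≤ 1 := by
    rw [hspow]
    exact Real.rpow_le_one_of_one_le_of_nonpos (by linarith) (by linarith)
  have hKα : K ≤ α * n := by
    calc K ≤ n * E * 1 := by rw [hK]; gcongr
      _ ≤ _ := by rw [mul_one, mul_comm]; gcongr
  obtain ⟨T, hT1, hTK, hTM⟩ := exists_config (m := fun i => μ i / σ) hn0 hs0 hp0 hp2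
    (sum_abs_rpow_le_of_mem_lpBall hσ hη hp0 hμ) hK1
  rw [hKw] at hTM
  set k := T.card with hk
  have hkn : k ≤ n := by simpa using T.card_le_univ
  have hk1 : (1 : ℝ) ≤ k := by exact_mod_cast hT1
  -- log(n/K) = w/2 + (p/2) log w, and p/2 < 1.
  have hlogK : Real.log (n / K) ≤ 3 / 2 * w := by
    have e : (n : ℝ) / K = E⁻¹ * s ^ p := by
      rw [hK, Real.rpow_neg hs0.le]; field_simp
    rw [e, Real.log_mul (by positivity) (by positivity), hspow, Real.log_rpow hw0]
    have h3 := Real.log_le_sub_one_of_pos hw0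
    have h4 : 0 ≤ Real.log w := Real.log_nonneg (by linarith)
    have h5 : p / 2 * Real.log w ≤ 1 * Real.log w := by gcongr; linarith
    have h6 : Real.log E⁻¹ = w / 2 := by rw [hw]; ring
    linarith
  -- k may be far below K; splitting off K/k costs k log(K/k) ≤ K − k.
  have hklog : k * Real.log (n / k) ≤ 2 * (K * w) := by
    have e : (n : ℝ) / k = (n / K) * (K / k) := by field_simp
    rw [e, Real.log_mul (by positivity) (by positivity), mul_add]
    have h3 : (k : ℝ) * Real.log (K / k) ≤ K := by
      have := Real.log_le_sub_one_of_pos (by positivity : 0 < K / k)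
      calc (k : ℝ) * Real.log (K / k) ≤ k * (K / k - 1) := by gcongr
        _ = K - k := by field_simp
        _ ≤ K := by linarith
    have h4 : (k : ℝ) * Real.log (n / K) ≤ K * (3 / 2 * w) := by
      calc (k : ℝ) * Real.log (n / K) ≤ k * (3 / 2 * w) := by gcongr
        _ ≤ _ := by gcongr
    nlinarith
  have hlogprior : -Real.log (prior k) ≤ c₂ * (k * Real.log (n / k)) := by
    have h3 := Real.log_le_log (by positivity) (hprior k hT1 (hTK.trans hKα))
    rw [Real.log_rpow (by positivity), ← inv_div, Real.log_inv] at h3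
    linarith
  have hKwK : K ≤ K * w := le_mul_of_one_le_right (by linarith) (by linarith)
  have hkγ : (k : ℝ) * (Real.log (1 + γ) / 2) ≤ γmax * (K * w) := by
    have hlogγ := Real.log_le_sub_one_of_pos (by linarith : (0 : ℝ) < 1 + γ)
    calc (k : ℝ) * (Real.log (1 + γ) / 2) ≤ k * γmax := by gcongr; linarith
      _ ≤ (K * w) * γmax := by gcongr; exact hTK.trans hKwK
      _ = _ := by ring
  have hgeo : ((n : ℝ) + 1) ^ 2 * r ^ n ≤ 1 := by
    refine (hN n hn).trans ?_
    rw [Real.rpow_neg_one, inv_mul_le_iff₀ (by positivity)]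
    have := Real.log_le_sub_one_of_pos (by linarith : (0 : ℝ) < n)
    linarith
  have hone := hp.1 0 (Nat.zero_le n)
  have hchoose := log_choose_le hT1 hkn
  have hc : c₂ * (k * Real.log (n / k)) ≤ c₂ * (2 * (K * w)) := by gcongr
  refine (H n σ γ prior est μ T hn0 hσ h1 h2 hp hest).trans (ENNReal.ofReal_le_ofReal ?_)
  have key : penalty n γ prior k + k + ∑ i ∈ Tᶜ, (μ i / σ) ^ 2 + (1 - prior 0) +
      ((n : ℝ) + 1) ^ 2 * r ^ n ≤ (2 * (1 + c₂) + γmax + 5) * (K * w) := by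
    have hTK' : (k : ℝ) ≤ K := hTK
    unfold penalty
    linarith
  calc _ ≤ σ ^ 2 * (C * ((2 * (1 + c₂) + γmax + 5) * (K * w))) := by gcongr
    _ = _ := by
      rw [← hKw, hspow, show (2 - p) / 2 = 1 - p / 2 by ring]; ring

end Rates

end

end GaussSeq

/-! ### Suprema over the balls. -/

theorem proposition1 (γmin γmax : ℝ) (hγmin : 0 < γmin) (hγmax : γmin ≤ γmax) :
    -- (i)
    (∀ (p : ℝ≥0∞) (c₀ : ℝ), 0 < p → 0 < c₀ →
      ∃ (C : ℝ) (N : ℕ), 0 < C ∧ ∀ n : ℕ, N ≤ n →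
        ∀ (σ γ η : ℝ) (prior : ℕ → ℝ) (est : (Fin n → ℝ) → Fin n → ℝ),
          0 < σ → γmin ≤ γ → γ ≤ γmax → 0 ≤ η → GaussSeq.IsPrior n prior →
          GaussSeq.IsMAPEstimator n σ γ prior est →
          Real.exp (-(c₀ * n)) ≤ prior n →
          GaussSeq.maxRisk σ est p η ≤ ENNReal.ofReal (C * (n * σ ^ 2))) ∧
    -- (ii)
    (∀ (p : ℝ≥0∞) (β c₁ : ℝ), 2 ≤ p → 0 ≤ β → 0 < c₁ →
      ∃ (C : ℝ) (N : ℕ), 0 < C ∧ ∀ n : ℕ, N ≤ n →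
        ∀ (σ γ η : ℝ) (prior : ℕ → ℝ) (est : (Fin n → ℝ) → Fin n → ℝ),
          0 < σ → γmin ≤ γ → γ ≤ γmax → 0 ≤ η → GaussSeq.IsPrior n prior →
          GaussSeq.IsMAPEstimator n σ γ prior est →
          (n : ℝ) ^ (-(c₁ * (n : ℝ) ^ (-β))) ≤ prior 0 →
          GaussSeq.maxRisk σ est p η ≤
            ENNReal.ofReal (C * (σ ^ 2 * n * η ^ 2 + σ ^ 2 * (n : ℝ) ^ (-β) * Real.log n))) ∧
    -- (iii)
    (∀ p c₂ : ℝ, 0 < p → p < 2 → 0 < c₂ →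
      ∃ (C : ℝ) (N : ℕ), 0 < C ∧ ∀ n : ℕ, N ≤ n →
        ∀ (σ γ η α : ℝ) (prior : ℕ → ℝ) (est : (Fin n → ℝ) → Fin n → ℝ),
          0 < σ → γmin ≤ γ → γ ≤ γmax → 0 ≤ η → GaussSeq.IsPrior n prior →
          GaussSeq.IsMAPEstimator n σ γ prior est →
          (n : ℝ)⁻¹ * (2 * Real.log n) ^ (p / 2) ≤ α → α ≤ Real.exp (-(8 * (γ + 3 / 4) ^ 2)) →
          (∀ κ : ℕ, 1 ≤ κ → (κ : ℝ) ≤ α * n → ((κ : ℝ) / n) ^ (c₂ * κ) ≤ prior κ) →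
          (n : ℝ)⁻¹ * (2 * Real.log n) ^ (p / 2) ≤ η ^ p → η ^ p ≤ α →
          GaussSeq.maxRisk σ est (ENNReal.ofReal p) η ≤
            ENNReal.ofReal
              (C * (σ ^ 2 * n * η ^ p * (2 * Real.log (η ^ (-p))) ^ (1 - p / 2)))) ∧
    -- (iv)
    (∀ p β c₁ : ℝ, 0 < p → p < 2 → 0 ≤ β → 0 < c₁ →
      ∃ (C : ℝ) (N : ℕ), 0 < C ∧ ∀ n : ℕ, N ≤ n →
        ∀ (σ γ η : ℝ) (prior : ℕ → ℝ) (est : (Fin n → ℝ) → Fin n → ℝ),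
          0 < σ → γmin ≤ γ → γ ≤ γmax → 0 ≤ η → GaussSeq.IsPrior n prior →
          GaussSeq.IsMAPEstimator n σ γ prior est →
          (n : ℝ) ^ (-(c₁ * (n : ℝ) ^ (-β))) ≤ prior 0 →
          η ^ p < (n : ℝ)⁻¹ * (2 * Real.log n) ^ (p / 2) →
          GaussSeq.maxRisk σ est (ENNReal.ofReal p) η ≤
            ENNReal.ofReal
              (C * (σ ^ 2 * (n : ℝ) ^ (2 / p) * η ^ 2 + σ ^ 2 * (n : ℝ) ^ (-β) * Real.log n))) := by
  refine ⟨?_, ?_, ?_, ?_⟩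
  · intro p c₀ _ hc₀
    obtain ⟨C, N, hC, H⟩ := GaussSeq.exists_risk_bound_of_prior_top hγmin hγmax hc₀
    refine ⟨C, N, hC, fun n hn σ γ η prior est hσ h1 h2 _ hp hest h0 => ?_⟩
    exact iSup₂_le fun μ _ => H n hn σ γ prior est μ hσ h1 h2 hp hest h0
  · intro p β c₁ hp2 _ hc₁
    obtain ⟨C, N, hC, hN, H⟩ :=
      GaussSeq.exists_risk_bound_of_prior_zero hγmin hγmax (β := β) hc₁
    refine ⟨C, N, hC, fun n hn σ γ η prior est hσ h1 h2 hη hp hest h0 => ?_⟩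
    refine iSup₂_le fun μ hμ => (H n hn σ γ prior est μ hσ h1 h2 hp hest h0).trans
      (ENNReal.ofReal_le_ofReal ?_)
    have h := GaussSeq.sum_sq_le_of_mem_lpBall_of_two_le (by omega) hσ hη hp2 hμ
    calc _ ≤ σ ^ 2 * (C * (n * η ^ 2 + (n : ℝ) ^ (-β) * Real.log n)) := by gcongr
      _ = _ := by ring
  · intro p c₂ hp0 hp2 hc₂
    obtain ⟨C, N, hC, H⟩ := GaussSeq.exists_risk_bound_of_sparse hγmin hγmax hp0 hp2 hc₂
    refine ⟨C, N, hC, fun n hn σ γ η α prior est hσ h1 h2 hη hp hest _ hα hprior hlow hηα => ?_⟩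
    exact iSup₂_le fun μ hμ =>
      H n hn σ γ η α prior est μ hσ h1 h2 hη hp hest hα hprior hlow hηα hμ
  · intro p β c₁ hp0 hp2 _ hc₁
    obtain ⟨C, N, hC, hN, H⟩ :=
      GaussSeq.exists_risk_bound_of_prior_zero hγmin hγmax (β := β) hc₁
    refine ⟨C, N, hC, fun n hn σ γ η prior est hσ h1 h2 hη hp hest h0 _ => ?_⟩
    refine iSup₂_le fun μ hμ => (H n hn σ γ prior est μ hσ h1 h2 hp hest h0).trans
      (ENNReal.ofReal_le_ofReal ?_)
    have h := GaussSeq.sum_sq_le_of_mem_lpBall_of_lt_two hσ hη hp0 hp2 hμ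
    calc _ ≤ σ ^ 2 * (C * ((n : ℝ) ^ (2 / p) * η ^ 2 + (n : ℝ) ^ (-β) * Real.log n)) := by gcongr
      _ = _ := by ring
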